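/- All Banach spaces are complex. A \emph{Köthe sequence space} is a Banach space $E\subseteq\mathbb C^{\mathbb N}$ with $\ell_1\subseteq E\subseteq\ell_\infty$, both inclusions having norm one, such that if $x\in\mathbb C^{\mathbb N}$, $y\in E$ and $|x(k)|\le|y(k)|$ for all $k$, then $x\in E$ and $\|x\|_E\le\|y\|_E$. For a normed space $E\subseteq\ell_\infty$ of sequences, its \emph{minimal kernel} is $E^{min}=\{y\cdot z: y\in E,\ z\in c_0\}$ (coordinatewise product) with $\|x\|_{E^{min}}=\inf\{\|y\|_E\|z\|_{\ell_\infty}: x=y\cdot z,\ y\in E,\ z\in c_0\}$; $E$ is \emph{minimal} if $E\overset{1}{=}E^{min}$, where $\overset{1}{=}$ means that both spaces consist of the same sequences with the same norms. If $E$ is a Köthe sequence space, so is $E^{min}$. A \emph{normed ideal of $n$-linear operators} $\mathfrak A$ assigns to all Banach spaces $X_1,\dots,X_n,Y$ a linear subspace $\mathfrak A(X_1,\dots,X_n;Y)$ of the space of continuous $n$-linear operators, with a norm $\|\cdot\|_{\mathfrak A}$, such that: for $\gamma_i\in X_i'$ and $f\in Y$, the operator $(x_1,\dots,x_n)\mapsto\gamma_1(x_1)\cdots\gamma_n(x_n)f$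 belongs to $\mathfrak A$ and has norm $\|\gamma_1\|\cdots\|\gamma_n\|\,\|f\|$; and for $T\in\mathfrak A(X_1,\dots,X_n;Y)$ and bounded linear operators $B_i:G_i\to X_i$, $A:Y\to H$ between Banach spaces, $A\circ T\circ(B_1,\dots,B_n)\in\mathfrak A(G_1,\dots,G_n;H)$ with norm at most $\|A\|\,\|T\|_{\mathfrak A}\|B_1\|\cdots\|B_n\|$. It is a \emph{Banach ideal} if all $\mathfrak A(X_1,\dots,X_n;Y)$ are complete. Its \emph{minimal kernel} $\mathfrak A^{min}$ consists of all $T=A\circ S\circ(B_1,\dots,B_n)$ with $S\in\mathfrak A$ and $A,B_1,\dots,B_n$ approximable (operator-norm limits of finite rank operators) between Banach spaces, and $\|T\|_{\mathfrak A^{min}}=\inf\|A\|\,\|S\|_{\mathfrak A}\|B_1\|\cdots\|B_n\|$ over all such factorizations; $\mathfrak A$ is \emph{minimal} if $\mathfrak A=\mathfrak A^{min}$ with equal norms. For Köthe sequence spaces $E,F$, let $\boldsymbol{\ell_n}(\mathfrak A;E,F)$ be the space of all $\alpha\in\ell_\infty$ such that $T_\alpha(x_1,\dots,x_n)=\alpha\cdot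 x_1\cdots x_n$ defines an operator $T_\alpha\in\mathfrak A(E,\dots,E;F)$, with $\|\alpha\|=\|T_\alpha\|_{\mathfrak A}$; $\boldsymbol{\ell_n}(\mathfrak A^{min};E,F)$ is defined in the same way. \textbf{Proposition.} Let $\mathfrak A$ be a normed ideal of $n$-linear operators and let $E$ and $F$ be Köthe sequence spaces. If $\mathfrak A$ is a Banach ideal, then $\boldsymbol{\ell_n}(\mathfrak A;E,F)$ is a Köthe sequence space. Moreover: (i) If $\mathfrak A$ is minimal and $F$ is minimal, then $\boldsymbol{\ell_n}(\mathfrak A;E,F)$ is minimal. (ii) $\boldsymbol{\ell_n}(\mathfrak A;E,F)^{min}\overset{1}{=}\boldsymbol{\ell_n}(\mathfrak A^{min};E,F^{min})$. -/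

import Mathlib

open Filter Topology

noncomputable section

/-! ### Sequence spaces -/

/-- A set of complex sequences together with a real-valued function on sequences; only the values
of `nrm` on `carrier` matter. -/
structure SeqSpace where
  carrier : Set (ℕ → ℂ)
  nrm : (ℕ → ℂ) → ℝ

namespace SeqSpace

/-- Equality of normed sequence spaces: the same sequences with the same norms. -/
def IsometricEq (X Y : SeqSpace) : Prop :=
  X.carrier = Y.carrier ∧ ∀ x ∈ X.carrier, X.nrm x = Y.nrm x

/-- Being a Köthe sequence space: a Banach space of sequences, lying between `ℓ₁` and `ℓ_∞` with
inclusions of norm one, and with the normal property. (Since `nrm` is a norm,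
nonnegativity and `nrm 0 = 0` follow from the first fields, definiteness from `coord_le`; that both
inclusions have norm at most one forces that they have norm exactly one, by testing on `e_k`.) -/
structure IsKothe (X : SeqSpace) : Prop where
  add_mem : ∀ x ∈ X.carrier, ∀ y ∈ X.carrier, x + y ∈ X.carrier
  smul_mem : ∀ (c : ℂ), ∀ x ∈ X.carrier, c • x ∈ X.carrier
  nrm_add_le : ∀ x ∈ X.carrier, ∀ y ∈ X.carrier, X.nrm (x + y) ≤ X.nrm x + X.nrm y
  nrm_smul : ∀ (c : ℂ), ∀ x ∈ X.carrier, X.nrm (c • x) = ‖c‖ * X.nrm x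
  l1_mem : ∀ x : ℕ → ℂ, Summable (fun k => ‖x k‖) → x ∈ X.carrier
  nrm_le_l1 : ∀ x : ℕ → ℂ, Summable (fun k => ‖x k‖) → X.nrm x ≤ ∑' k, ‖x k‖
  coord_le : ∀ x ∈ X.carrier, ∀ k, ‖x k‖ ≤ X.nrm x
  normal_mem : ∀ x : ℕ → ℂ, ∀ y ∈ X.carrier, (∀ k, ‖x k‖ ≤ ‖y k‖) → x ∈ X.carrier
  normal_nrm : ∀ x : ℕ → ℂ, ∀ y ∈ X.carrier, (∀ k, ‖x k‖ ≤ ‖y k‖) → X.nrm x ≤ X.nrm y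
  complete : ∀ u : ℕ → ℕ → ℂ, (∀ m, u m ∈ X.carrier) →
    (∀ ε : ℝ, 0 < ε → ∃ N, ∀ m, N ≤ m → ∀ l, N ≤ l → X.nrm (u m - u l) < ε) →
    ∃ x ∈ X.carrier, Tendsto (fun m => X.nrm (u m - x)) atTop (𝓝 0)

/-- The minimal kernel: the bounded sequences `x = y · z` with `y` in the space and `z ∈ c₀`,
normed by the infimum of `‖y‖ ‖z‖_∞` over all such factorizations. -/
def minKernel (X : SeqSpace) : SeqSpace where
  carrier := {x | (∃ C : ℝ, ∀ k, ‖x k‖ ≤ C) ∧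
    ∃ y ∈ X.carrier, ∃ z : ℕ → ℂ, Tendsto z atTop (𝓝 0) ∧ x = y * z}
  nrm x := sInf {r : ℝ | ∃ y ∈ X.carrier, ∃ z : ℕ → ℂ, Tendsto z atTop (𝓝 0) ∧ x = y * z ∧
    r = X.nrm y * ⨆ k, ‖z k‖}

/-- A sequence space is minimal if it coincides isometrically with its minimal kernel. -/
def IsMinimal (X : SeqSpace) : Prop := X.IsometricEq X.minKernel

end SeqSpace

/-- A Köthe sequence space. -/
structure KotheSpace extends SeqSpace where
  isKothe : toSeqSpace.IsKothe

namespace KotheSpace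

variable (E : KotheSpace)

/-- The underlying vector space of a Köthe sequence space. -/
def toSubmodule : Submodule ℂ (ℕ → ℂ) where
  carrier := E.carrier
  add_mem' {a b} ha hb := E.isKothe.add_mem a ha b hb
  zero_mem' := E.isKothe.l1_mem 0 (by simp)
  smul_mem' c x hx := E.isKothe.smul_mem c x hx

/-- The Banach space of elements of a Köthe sequence space. -/
def Elem : Type := E.toSubmodule

instance : AddCommGroup E.Elem := inferInstanceAs (AddCommGroup E.toSubmodule)

instance : Module ℂ E.Elem := inferInstanceAs (Module ℂ E.toSubmodule)

/-- An element of a Köthe sequence space, as a sequence. -/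
def Elem.seq {E : KotheSpace} (x : E.Elem) : ℕ → ℂ := Subtype.val x

theorem Elem.mem {E : KotheSpace} (x : E.Elem) : x.seq ∈ E.carrier := Subtype.property x

/-- A sequence in the carrier, as an element of the Banach space. -/
def Elem.mk {E : KotheSpace} (x : ℕ → ℂ) (hx : x ∈ E.carrier) : E.Elem := Subtype.mk x hx

instance : Norm E.Elem := ⟨fun x => E.nrm x.seq⟩

theorem zero_mem : (0 : ℕ → ℂ) ∈ E.carrier := E.toSubmodule.zero_mem

theorem sub_mem {x y : ℕ → ℂ} (hx : x ∈ E.carrier) (hy : y ∈ E.carrier) : x - y ∈ E.carrier :=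
  E.toSubmodule.sub_mem hx hy

theorem nrm_nonneg {x : ℕ → ℂ} (hx : x ∈ E.carrier) : 0 ≤ E.nrm x :=
  (norm_nonneg (x 0)).trans (E.isKothe.coord_le x hx 0)

theorem elem_core : NormedSpace.Core ℂ E.Elem where
  norm_nonneg x := E.nrm_nonneg x.mem
  norm_smul c x := E.isKothe.nrm_smul c x.seq x.mem
  norm_triangle x y := E.isKothe.nrm_add_le x.seq x.mem y.seq y.mem
  norm_eq_zero_iff x := by
    constructor
    · intro h
      apply Subtype.ext
      funext k
      have h1 := E.isKothe.coord_le x.seq x.mem k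
      have h2 : E.nrm x.seq = 0 := h
      rw [h2] at h1
      exact norm_le_zero_iff.1 h1
    · rintro rfl
      have h := E.isKothe.nrm_smul 0 0 E.zero_mem
      have h2 : E.nrm 0 = 0 := by simpa using h
      exact h2

instance : NormedAddCommGroup E.Elem := NormedAddCommGroup.ofCore E.elem_core

instance : NormedSpace ℂ E.Elem := NormedSpace.ofCore E.elem_core

theorem Elem.norm_def {E : KotheSpace} (x : E.Elem) : ‖x‖ = E.nrm x.seq := rfl

instance : CompleteSpace E.Elem := by
  refine Metric.complete_of_cauchySeq_tendsto fun u hu => ?_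
  rw [Metric.cauchySeq_iff] at hu
  obtain ⟨x, hx, hlim⟩ := E.isKothe.complete (fun m => (u m).seq) (fun m => (u m).mem) (by
    intro ε hε
    obtain ⟨N, hN⟩ := hu ε hε
    refine ⟨N, fun m hm l hl => ?_⟩
    have h := hN m hm l hl
    rw [dist_eq_norm] at h
    exact h)
  refine ⟨Elem.mk x hx, ?_⟩
  rw [tendsto_iff_norm_sub_tendsto_zero]
  exact hlim

/-! The minimal kernel of a Köthe sequence space is a Köthe sequence space: it consists of the
elements whose tails tend to zero in norm, and carries the norm of the space. -/

/-- The sequence `x` with its first `N` coordinates replaced by zero. -/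
def tail (N : ℕ) (x : ℕ → ℂ) : ℕ → ℂ := fun k => if N ≤ k then x k else 0

theorem norm_tail_le (N : ℕ) (x : ℕ → ℂ) (k : ℕ) : ‖tail N x k‖ ≤ ‖x k‖ := by
  unfold tail
  split_ifs <;> simp

theorem tail_mem {x : ℕ → ℂ} (hx : x ∈ E.carrier) (N : ℕ) : tail N x ∈ E.carrier :=
  E.isKothe.normal_mem _ x hx (norm_tail_le N x)

theorem nrm_tail_le {x : ℕ → ℂ} (hx : x ∈ E.carrier) (N : ℕ) : E.nrm (tail N x) ≤ E.nrm x :=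
  E.isKothe.normal_nrm _ x hx (norm_tail_le N x)

theorem bddAbove_of_tendsto {z : ℕ → ℂ} (hz : Tendsto z atTop (𝓝 0)) :
    BddAbove (Set.range fun k => ‖z k‖) :=
  hz.norm.bddAbove_range

theorem mul_mem_of_bound {y w : ℕ → ℂ} (hy : y ∈ E.carrier) {C : ℝ} (hC : 0 ≤ C)
    (h : ∀ k, ‖w k‖ ≤ C * ‖y k‖) : w ∈ E.carrier ∧ E.nrm w ≤ C * E.nrm y := by
  have hb : ∀ k, ‖w k‖ ≤ ‖((C : ℂ) • y) k‖ := by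
    intro k
    simpa [abs_of_nonneg hC] using h k
  have hm := E.isKothe.smul_mem (C : ℂ) y hy
  refine ⟨E.isKothe.normal_mem w _ hm hb, ?_⟩
  have h1 := E.isKothe.normal_nrm w _ hm hb
  rw [E.isKothe.nrm_smul _ y hy] at h1
  simpa [abs_of_nonneg hC] using h1

theorem tail_tendsto_of_mul {y z : ℕ → ℂ} (hy : y ∈ E.carrier) (hz : Tendsto z atTop (𝓝 0)) :
    Tendsto (fun N => E.nrm (tail N (y * z))) atTop (𝓝 0) := by
  rw [Metric.tendsto_atTop]
  intro ε hε
  have hy0 := E.nrm_nonneg hy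
  set δ : ℝ := ε / (E.nrm y + 1) with hδ
  have hδ0 : 0 < δ := by positivity
  obtain ⟨N, hN⟩ := Metric.tendsto_atTop.1 hz δ hδ0
  refine ⟨N, fun M hM => ?_⟩
  have hb : ∀ k, ‖tail M (y * z) k‖ ≤ δ * ‖y k‖ := by
    intro k
    unfold tail
    split_ifs with h
    · have := hN k (hM.trans h)
      rw [dist_zero_right] at this
      rw [Pi.mul_apply, norm_mul, mul_comm]
      gcongr
    · simp only [norm_zero]
      positivity
  obtain ⟨hm, hle⟩ := E.mul_mem_of_bound hy hδ0.le hb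
  rw [Real.dist_eq, sub_zero, abs_of_nonneg (E.nrm_nonneg hm)]
  refine hle.trans_lt ?_
  rw [hδ, div_mul_eq_mul_div, div_lt_iff₀ (by positivity)]
  nlinarith

/-- Evaluation of a coordinate, as a continuous linear functional. -/
def coord (k : ℕ) : E.Elem →L[ℂ] ℂ :=
  LinearMap.mkContinuous
    { toFun := fun x => x.seq k
      map_add' := fun _ _ => rfl
      map_smul' := fun _ _ => rfl } 1
    (fun x => by rw [one_mul]; exact E.isKothe.coord_le x.seq x.mem k)

theorem factor_of_tail {x : ℕ → ℂ} (hx : x ∈ E.carrier)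
    (ht : Tendsto (fun N => E.nrm (tail N x)) atTop (𝓝 0)) {ε : ℝ} (hε : 0 < ε) :
    ∃ y ∈ E.carrier, ∃ z : ℕ → ℂ, Tendsto z atTop (𝓝 0) ∧ x = y * z ∧ (∀ k, ‖z k‖ ≤ 1) ∧
      E.nrm y ≤ E.nrm x + ε := by
  have hch : ∀ k : ℕ, ∃ N, k ≤ N ∧ E.nrm (tail N x) ≤ ε / 2 / 2 ^ k := by
    intro k
    have h1 : ∀ᶠ N in atTop, E.nrm (tail N x) < ε / 2 / 2 ^ k :=
      ht.eventually (gt_mem_nhds (by positivity))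
    obtain ⟨N, h2, h3⟩ := ((eventually_ge_atTop k).and h1).exists
    exact ⟨N, h2, h3.le⟩
  choose N hkN hN using hch
  let v : ℕ → E.Elem := fun k => Elem.mk (tail (N k) x) (E.tail_mem hx (N k))
  have hv : ∀ k, ‖v k‖ ≤ ε / 2 / 2 ^ k := hN
  have hsum : HasSum (fun k : ℕ => ε / 2 / 2 ^ k) ε := hasSum_geometric_two' ε
  have hvs : Summable v := Summable.of_norm_bounded hsum.summable hv
  let x' : E.Elem := Elem.mk x hx
  let y : E.Elem := x' + ∑' k, v k
  let c : ℕ → ℕ := fun j => 1 + ((Finset.range (j + 1)).filter fun k => N k ≤ j).card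
  have hcpos : ∀ j, (1 : ℝ) ≤ c j := fun j => by
    exact_mod_cast Nat.le_add_right 1 _
  have hyc : ∀ j, y.seq j = (c j : ℂ) * x j := by
    intro j
    have h1 : y.seq j = x j + E.coord j (∑' k, v k) := rfl
    rw [h1, (E.coord j).map_tsum hvs]
    have h2 : ∀ k, E.coord j (v k) = if N k ≤ j then x j else 0 := fun k => rfl
    simp only [h2]
    rw [tsum_eq_sum (s := Finset.range (j + 1))]
    · rw [← Finset.sum_filter, Finset.sum_const, nsmul_eq_mul]
      simp only [c]
      push_cast
      ring
    · intro k hk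
      rw [if_neg]
      intro h
      exact hk (Finset.mem_range.2 (Nat.lt_succ_of_le ((hkN k).trans h)))
  have hctop : Tendsto c atTop atTop := by
    rw [tendsto_atTop]
    intro K
    refine (eventually_ge_atTop (∑ k ∈ Finset.range K, N k)).mono fun j hj => ?_
    have hsub : Finset.range K ⊆ (Finset.range (j + 1)).filter fun k => N k ≤ j := by
      intro k hk
      have h1 : N k ≤ j :=
        (Finset.single_le_sum (f := N) (fun _ _ => Nat.zero_le _) hk).trans hj
      exact Finset.mem_filter.2
        ⟨Finset.mem_range.2 (Nat.lt_succ_of_le ((hkN k).trans h1)), h1⟩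
    have := Finset.card_le_card hsub
    rw [Finset.card_range] at this
    simp only [c]
    omega
  refine ⟨y.seq, y.mem, fun j => ((c j : ℂ))⁻¹, ?_, ?_, ?_, ?_⟩
  · rw [tendsto_zero_iff_norm_tendsto_zero]
    have : (fun j => ‖((c j : ℂ))⁻¹‖) = fun j => ((c j : ℝ))⁻¹ := by
      funext j
      simp
    rw [this]
    exact tendsto_inv_atTop_zero.comp (tendsto_natCast_atTop_atTop.comp hctop)
  · funext j
    have hc : (c j : ℂ) ≠ 0 := by
      have := hcpos j
      intro h
      have h' : c j = 0 := by exact_mod_cast h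
      rw [h'] at this
      norm_num at this
    rw [Pi.mul_apply, hyc j]
    field_simp
  · intro j
    rw [norm_inv, Complex.norm_natCast]
    exact inv_le_one_of_one_le₀ (hcpos j)
  · have h1 : ‖∑' k, v k‖ ≤ ε := tsum_of_norm_bounded hsum hv
    have h2 : ‖y‖ ≤ ‖x'‖ + ε := (norm_add_le _ _).trans (by gcongr)
    exact h2

theorem mem_minKernel_iff (x : ℕ → ℂ) : x ∈ E.toSeqSpace.minKernel.carrier ↔
    x ∈ E.carrier ∧ Tendsto (fun N => E.nrm (tail N x)) atTop (𝓝 0) := by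
  constructor
  · rintro ⟨-, y, hy, z, hz, rfl⟩
    refine ⟨?_, E.tail_tendsto_of_mul hy hz⟩
    obtain ⟨C, hC⟩ := bddAbove_of_tendsto hz
    have hC' : ∀ k, ‖z k‖ ≤ C := fun k => hC ⟨k, rfl⟩
    refine (E.mul_mem_of_bound hy ((norm_nonneg _).trans (hC' 0)) fun k => ?_).1
    rw [Pi.mul_apply, norm_mul, mul_comm]
    gcongr
    exact hC' k
  · rintro ⟨hx, ht⟩
    obtain ⟨y, hy, z, hz, hxy, -, -⟩ := E.factor_of_tail hx ht one_pos
    exact ⟨⟨E.nrm x, E.isKothe.coord_le x hx⟩, y, hy, z, hz, hxy⟩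

theorem minKernel_nrm {x : ℕ → ℂ} (hx : x ∈ E.toSeqSpace.minKernel.carrier) :
    E.toSeqSpace.minKernel.nrm x = E.nrm x := by
  obtain ⟨hxE, ht⟩ := (E.mem_minKernel_iff x).1 hx
  have hlow : ∀ r ∈ {r : ℝ | ∃ y ∈ E.carrier, ∃ z : ℕ → ℂ, Tendsto z atTop (𝓝 0) ∧ x = y * z ∧
      r = E.nrm y * ⨆ k, ‖z k‖}, E.nrm x ≤ r := by
    rintro r ⟨y, hy, z, hz, rfl, rfl⟩
    have hz' : ∀ k, ‖z k‖ ≤ ⨆ k, ‖z k‖ := le_ciSup (bddAbove_of_tendsto hz)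
    rw [mul_comm (E.nrm y)]
    refine (E.mul_mem_of_bound hy ((norm_nonneg _).trans (hz' 0)) fun k => ?_).2
    rw [Pi.mul_apply, norm_mul, mul_comm]
    gcongr
    exact hz' k
  apply le_antisymm
  · refine le_of_forall_pos_le_add fun ε hε => ?_
    obtain ⟨y, hy, z, hz, hxy, hz1, hle⟩ := E.factor_of_tail hxE ht hε
    refine (csInf_le ⟨_, hlow⟩ ⟨y, hy, z, hz, hxy, rfl⟩).trans ?_
    calc E.nrm y * ⨆ k, ‖z k‖ ≤ E.nrm y * 1 :=
          mul_le_mul_of_nonneg_left (ciSup_le hz1) (E.nrm_nonneg hy)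
      _ ≤ E.nrm x + ε := by rw [mul_one]; exact hle
  · obtain ⟨-, y, hy, z, hz, hxy⟩ := hx
    exact le_csInf ⟨_, y, hy, z, hz, hxy, rfl⟩ hlow

theorem minKernel_isKothe : E.toSeqSpace.minKernel.IsKothe := by
  have hadd : ∀ x ∈ E.toSeqSpace.minKernel.carrier, ∀ y ∈ E.toSeqSpace.minKernel.carrier,
      x + y ∈ E.toSeqSpace.minKernel.carrier := by
    intro x hx y hy
    rw [mem_minKernel_iff] at hx hy ⊢
    refine ⟨E.isKothe.add_mem x hx.1 y hy.1, ?_⟩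
    refine squeeze_zero
      (fun N => E.nrm_nonneg (E.tail_mem (E.isKothe.add_mem x hx.1 y hy.1) N))
      (fun N => ?_) (by simpa using hx.2.add hy.2)
    have h : tail N (x + y) = tail N x + tail N y := by
      funext k
      simp only [tail, Pi.add_apply]
      split_ifs <;> simp
    rw [h]
    exact E.isKothe.nrm_add_le _ (E.tail_mem hx.1 N) _ (E.tail_mem hy.1 N)
  have hsmul : ∀ (c : ℂ), ∀ x ∈ E.toSeqSpace.minKernel.carrier,
      c • x ∈ E.toSeqSpace.minKernel.carrier := by
    intro c x hx
    rw [mem_minKernel_iff] at hx ⊢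
    refine ⟨E.isKothe.smul_mem c x hx.1, ?_⟩
    have h : ∀ N, tail N (c • x) = c • tail N x := by
      intro N
      funext k
      simp only [tail, Pi.smul_apply]
      split_ifs <;> simp
    have h2 : (fun N => E.nrm (tail N (c • x))) = fun N => ‖c‖ * E.nrm (tail N x) := by
      funext N
      rw [h N, E.isKothe.nrm_smul c _ (E.tail_mem hx.1 N)]
    rw [h2]
    simpa using hx.2.const_mul ‖c‖
  have hsub : ∀ x ∈ E.toSeqSpace.minKernel.carrier, ∀ y ∈ E.toSeqSpace.minKernel.carrier,
      x - y ∈ E.toSeqSpace.minKernel.carrier := by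
    intro x hx y hy
    have := hadd x hx _ (hsmul (-1) y hy)
    rwa [neg_one_smul, ← sub_eq_add_neg] at this
  have hnormal : ∀ x : ℕ → ℂ, ∀ y ∈ E.toSeqSpace.minKernel.carrier,
      (∀ k, ‖x k‖ ≤ ‖y k‖) → x ∈ E.toSeqSpace.minKernel.carrier := by
    intro x y hy h
    rw [mem_minKernel_iff] at hy ⊢
    have hx := E.isKothe.normal_mem x y hy.1 h
    refine ⟨hx, squeeze_zero (fun N => E.nrm_nonneg (E.tail_mem hx N)) (fun N => ?_) hy.2⟩
    refine E.isKothe.normal_nrm _ _ (E.tail_mem hy.1 N) fun k => ?_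
    simp only [tail]
    split_ifs
    · exact h k
    · exact le_rfl
  have hl1 : ∀ x : ℕ → ℂ, Summable (fun k => ‖x k‖) → x ∈ E.toSeqSpace.minKernel.carrier := by
    intro x hx
    rw [mem_minKernel_iff]
    have hxE := E.isKothe.l1_mem x hx
    refine ⟨hxE, ?_⟩
    refine squeeze_zero (fun N => E.nrm_nonneg (E.tail_mem hxE N)) (fun N => ?_)
      (tendsto_sum_nat_add fun k => ‖x k‖)
    have hs : Summable fun k => ‖tail N x k‖ :=
      Summable.of_nonneg_of_le (fun _ => norm_nonneg _) (norm_tail_le N x) hx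
    refine (E.isKothe.nrm_le_l1 _ hs).trans (le_of_eq ?_)
    rw [← hs.sum_add_tsum_nat_add N, Finset.sum_eq_zero, zero_add]
    · refine tsum_congr fun k => ?_
      simp [tail]
    · intro k hk
      have : ¬ N ≤ k := not_le.2 (Finset.mem_range.1 hk)
      simp [tail, this]
  have hE : ∀ x ∈ E.toSeqSpace.minKernel.carrier, x ∈ E.carrier :=
    fun x hx => ((E.mem_minKernel_iff x).1 hx).1
  refine
    { add_mem := hadd
      smul_mem := hsmul
      nrm_add_le := fun x hx y hy => ?_
      nrm_smul := fun c x hx => ?_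
      l1_mem := hl1
      nrm_le_l1 := fun x hx => ?_
      coord_le := fun x hx k => ?_
      normal_mem := hnormal
      normal_nrm := fun x y hy h => ?_
      complete := fun u hu hc => ?_ }
  · rw [E.minKernel_nrm hx, E.minKernel_nrm hy, E.minKernel_nrm (hadd x hx y hy)]
    exact E.isKothe.nrm_add_le x (hE x hx) y (hE y hy)
  · rw [E.minKernel_nrm hx, E.minKernel_nrm (hsmul c x hx)]
    exact E.isKothe.nrm_smul c x (hE x hx)
  · rw [E.minKernel_nrm (hl1 x hx)]
    exact E.isKothe.nrm_le_l1 x hx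
  · rw [E.minKernel_nrm hx]
    exact E.isKothe.coord_le x (hE x hx) k
  · rw [E.minKernel_nrm hy, E.minKernel_nrm (hnormal x y hy h)]
    exact E.isKothe.normal_nrm x y (hE y hy) h
  · obtain ⟨x, hx, hlim⟩ := E.isKothe.complete u (fun m => hE _ (hu m)) (by
      intro ε hε
      obtain ⟨N, hN⟩ := hc ε hε
      refine ⟨N, fun m hm l hl => ?_⟩
      rw [← E.minKernel_nrm (hsub _ (hu m) _ (hu l))]
      exact hN m hm l hl)
    have hxm : x ∈ E.toSeqSpace.minKernel.carrier := by
      rw [mem_minKernel_iff]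
      refine ⟨hx, ?_⟩
      rw [Metric.tendsto_atTop]
      intro ε hε
      obtain ⟨m, hm⟩ := (hlim.eventually (gt_mem_nhds (half_pos hε))).exists
      have hum := (E.mem_minKernel_iff _).1 (hu m)
      obtain ⟨N, hN⟩ := eventually_atTop.1 (hum.2.eventually (gt_mem_nhds (half_pos hε)))
      refine ⟨N, fun M hM => ?_⟩
      rw [Real.dist_eq, sub_zero, abs_of_nonneg (E.nrm_nonneg (E.tail_mem hx M))]
      have hd := E.sub_mem hum.1 hx
      have hneg : (-1 : ℂ) • tail M (u m - x) ∈ E.carrier :=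
        E.isKothe.smul_mem _ _ (E.tail_mem hd M)
      have h : tail M x = tail M (u m) + (-1 : ℂ) • tail M (u m - x) := by
        funext k
        simp only [tail, Pi.add_apply, Pi.smul_apply, Pi.sub_apply]
        split_ifs <;> simp
      rw [h]
      refine (E.isKothe.nrm_add_le _ (E.tail_mem hum.1 M) _ hneg).trans_lt ?_
      rw [E.isKothe.nrm_smul _ _ (E.tail_mem hd M)]
      have h1 := hN M hM
      have h2 := E.nrm_tail_le hd M
      simp only [norm_neg, norm_one, one_mul]
      linarith
    refine ⟨x, hxm, ?_⟩
    have h : (fun m => E.toSeqSpace.minKernel.nrm (u m - x)) = fun m => E.nrm (u m - x) := by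
      funext m
      exact E.minKernel_nrm (hsub _ (hu m) _ hxm)
    rw [h]
    exact hlim

/-- The minimal kernel `E^min` of a Köthe sequence space, as a Köthe sequence space. -/
def min : KotheSpace := ⟨E.toSeqSpace.minKernel, E.minKernel_isKothe⟩

end KotheSpace

/-! ### Ideals of multilinear operators -/

/-- A class of continuous `n`-linear operators between complex Banach spaces together with a
real-valued function on operators; only the values of `nrm` on the class matter. -/
structure MultClass (n : ℕ) where
  mem : ∀ (X : Fin n → Type) (Y : Type)
    [∀ i, NormedAddCommGroup (X i)] [∀ i, NormedSpace ℂ (X i)] [∀ i, CompleteSpace (X i)]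
    [NormedAddCommGroup Y] [NormedSpace ℂ Y] [CompleteSpace Y],
    Set (ContinuousMultilinearMap ℂ X Y)
  nrm : ∀ (X : Fin n → Type) (Y : Type)
    [∀ i, NormedAddCommGroup (X i)] [∀ i, NormedSpace ℂ (X i)] [∀ i, CompleteSpace (X i)]
    [NormedAddCommGroup Y] [NormedSpace ℂ Y] [CompleteSpace Y],
    ContinuousMultilinearMap ℂ X Y → ℝ

/-- The operator `(x₁, …, xₙ) ↦ γ₁(x₁) ⋯ γₙ(xₙ) · f`. -/
def rankOne {n : ℕ} {X : Fin n → Type} {Y : Type}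
    [∀ i, NormedAddCommGroup (X i)] [∀ i, NormedSpace ℂ (X i)]
    [NormedAddCommGroup Y] [NormedSpace ℂ Y]
    (γ : ∀ i, X i →L[ℂ] ℂ) (f : Y) : ContinuousMultilinearMap ℂ X Y :=
  ((ContinuousMultilinearMap.mkPiAlgebra ℂ (Fin n) ℂ).compContinuousLinearMap γ).smulRight f

/-- The operator `A ∘ T ∘ (B₁, …, Bₙ)`. -/
def sandwich {n : ℕ} {X G : Fin n → Type} {Y H : Type}
    [∀ i, NormedAddCommGroup (X i)] [∀ i, NormedSpace ℂ (X i)]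
    [∀ i, NormedAddCommGroup (G i)] [∀ i, NormedSpace ℂ (G i)]
    [NormedAddCommGroup Y] [NormedSpace ℂ Y] [NormedAddCommGroup H] [NormedSpace ℂ H]
    (A : Y →L[ℂ] H) (T : ContinuousMultilinearMap ℂ X Y) (B : ∀ i, G i →L[ℂ] X i) :
    ContinuousMultilinearMap ℂ G H :=
  A.compContinuousMultilinearMap (T.compContinuousLinearMap B)

/-- The approximable operators: the closure, in operator norm, of the finite rank operators. -/
def IsApproximable {X Y : Type} [NormedAddCommGroup X] [NormedSpace ℂ X]
    [NormedAddCommGroup Y] [NormedSpace ℂ Y] (A : X →L[ℂ] Y) : Prop :=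
  A ∈ closure {R : X →L[ℂ] Y | FiniteDimensional ℂ (LinearMap.range (R : X →ₗ[ℂ] Y))}

namespace MultClass

variable {n : ℕ}

/-- Being a normed ideal of `n`-linear operators. (Closure under scalar multiples follows from
`sandwich_mem`, nonnegativity of the norm from `nrm_add_le` and `nrm_smul`.) -/
structure IsNormedIdeal (𝔄 : MultClass n) : Prop where
  add_mem : ∀ (X : Fin n → Type) (Y : Type)
    [∀ i, NormedAddCommGroup (X i)] [∀ i, NormedSpace ℂ (X i)] [∀ i, CompleteSpace (X i)]
    [NormedAddCommGroup Y] [NormedSpace ℂ Y] [CompleteSpace Y],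
    ∀ S ∈ 𝔄.mem X Y, ∀ T ∈ 𝔄.mem X Y, S + T ∈ 𝔄.mem X Y
  sandwich_mem : ∀ (X G : Fin n → Type) (Y H : Type)
    [∀ i, NormedAddCommGroup (X i)] [∀ i, NormedSpace ℂ (X i)] [∀ i, CompleteSpace (X i)]
    [∀ i, NormedAddCommGroup (G i)] [∀ i, NormedSpace ℂ (G i)] [∀ i, CompleteSpace (G i)]
    [NormedAddCommGroup Y] [NormedSpace ℂ Y] [CompleteSpace Y]
    [NormedAddCommGroup H] [NormedSpace ℂ H] [CompleteSpace H],
    ∀ T ∈ 𝔄.mem X Y, ∀ (A : Y →L[ℂ] H) (B : ∀ i, G i →L[ℂ] X i), sandwich A T B ∈ 𝔄.mem G H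
  rankOne_mem : ∀ (X : Fin n → Type) (Y : Type)
    [∀ i, NormedAddCommGroup (X i)] [∀ i, NormedSpace ℂ (X i)] [∀ i, CompleteSpace (X i)]
    [NormedAddCommGroup Y] [NormedSpace ℂ Y] [CompleteSpace Y],
    ∀ (γ : ∀ i, X i →L[ℂ] ℂ) (f : Y), rankOne γ f ∈ 𝔄.mem X Y
  nrm_add_le : ∀ (X : Fin n → Type) (Y : Type)
    [∀ i, NormedAddCommGroup (X i)] [∀ i, NormedSpace ℂ (X i)] [∀ i, CompleteSpace (X i)]
    [NormedAddCommGroup Y] [NormedSpace ℂ Y] [CompleteSpace Y],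
    ∀ S ∈ 𝔄.mem X Y, ∀ T ∈ 𝔄.mem X Y, 𝔄.nrm X Y (S + T) ≤ 𝔄.nrm X Y S + 𝔄.nrm X Y T
  nrm_smul : ∀ (X : Fin n → Type) (Y : Type)
    [∀ i, NormedAddCommGroup (X i)] [∀ i, NormedSpace ℂ (X i)] [∀ i, CompleteSpace (X i)]
    [NormedAddCommGroup Y] [NormedSpace ℂ Y] [CompleteSpace Y],
    ∀ (c : ℂ), ∀ T ∈ 𝔄.mem X Y, 𝔄.nrm X Y (c • T) = ‖c‖ * 𝔄.nrm X Y T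
  eq_zero_of_nrm : ∀ (X : Fin n → Type) (Y : Type)
    [∀ i, NormedAddCommGroup (X i)] [∀ i, NormedSpace ℂ (X i)] [∀ i, CompleteSpace (X i)]
    [NormedAddCommGroup Y] [NormedSpace ℂ Y] [CompleteSpace Y],
    ∀ T ∈ 𝔄.mem X Y, 𝔄.nrm X Y T = 0 → T = 0
  nrm_rankOne : ∀ (X : Fin n → Type) (Y : Type)
    [∀ i, NormedAddCommGroup (X i)] [∀ i, NormedSpace ℂ (X i)] [∀ i, CompleteSpace (X i)]
    [NormedAddCommGroup Y] [NormedSpace ℂ Y] [CompleteSpace Y],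
    ∀ (γ : ∀ i, X i →L[ℂ] ℂ) (f : Y), 𝔄.nrm X Y (rankOne γ f) = (∏ i, ‖γ i‖) * ‖f‖
  nrm_sandwich_le : ∀ (X G : Fin n → Type) (Y H : Type)
    [∀ i, NormedAddCommGroup (X i)] [∀ i, NormedSpace ℂ (X i)] [∀ i, CompleteSpace (X i)]
    [∀ i, NormedAddCommGroup (G i)] [∀ i, NormedSpace ℂ (G i)] [∀ i, CompleteSpace (G i)]
    [NormedAddCommGroup Y] [NormedSpace ℂ Y] [CompleteSpace Y]
    [NormedAddCommGroup H] [NormedSpace ℂ H] [CompleteSpace H],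
    ∀ T ∈ 𝔄.mem X Y, ∀ (A : Y →L[ℂ] H) (B : ∀ i, G i →L[ℂ] X i),
      𝔄.nrm G H (sandwich A T B) ≤ ‖A‖ * 𝔄.nrm X Y T * ∏ i, ‖B i‖

/-- Being a Banach ideal: a normed ideal each of whose components is complete. -/
structure IsBanachIdeal (𝔄 : MultClass n) : Prop extends IsNormedIdeal 𝔄 where
  complete : ∀ (X : Fin n → Type) (Y : Type)
    [∀ i, NormedAddCommGroup (X i)] [∀ i, NormedSpace ℂ (X i)] [∀ i, CompleteSpace (X i)]
    [NormedAddCommGroup Y] [NormedSpace ℂ Y] [CompleteSpace Y],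
    ∀ u : ℕ → ContinuousMultilinearMap ℂ X Y, (∀ m, u m ∈ 𝔄.mem X Y) →
      (∀ ε : ℝ, 0 < ε → ∃ N, ∀ m, N ≤ m → ∀ l, N ≤ l → 𝔄.nrm X Y (u m - u l) < ε) →
      ∃ T ∈ 𝔄.mem X Y, Tendsto (fun m => 𝔄.nrm X Y (u m - T)) atTop (𝓝 0)

/-- A factorization `T = A ∘ S ∘ (B₁, …, Bₙ)` through Banach spaces with `S` in the class `𝔄` and
`A, B₁, …, Bₙ` approximable. -/
structure MinFactorization (𝔄 : MultClass n) {X : Fin n → Type} {Y : Type}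
    [∀ i, NormedAddCommGroup (X i)] [∀ i, NormedSpace ℂ (X i)]
    [NormedAddCommGroup Y] [NormedSpace ℂ Y] (T : ContinuousMultilinearMap ℂ X Y) where
  Z : Fin n → Type
  W : Type
  [instZ₁ : ∀ i, NormedAddCommGroup (Z i)]
  [instZ₂ : ∀ i, NormedSpace ℂ (Z i)]
  [instZ₃ : ∀ i, CompleteSpace (Z i)]
  [instW₁ : NormedAddCommGroup W]
  [instW₂ : NormedSpace ℂ W]
  [instW₃ : CompleteSpace W]
  A : W →L[ℂ] Y
  S : ContinuousMultilinearMap ℂ Z W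
  B : ∀ i, X i →L[ℂ] Z i
  approx_A : IsApproximable A
  mem_S : S ∈ 𝔄.mem Z W
  approx_B : ∀ i, IsApproximable (B i)
  eq : T = sandwich A S B

/-- The quantity `‖A‖ ‖S‖_𝔄 ‖B₁‖ ⋯ ‖Bₙ‖` of a factorization. -/
def MinFactorization.cost {𝔄 : MultClass n} {X : Fin n → Type} {Y : Type}
    [∀ i, NormedAddCommGroup (X i)] [∀ i, NormedSpace ℂ (X i)]
    [NormedAddCommGroup Y] [NormedSpace ℂ Y] {T : ContinuousMultilinearMap ℂ X Y}
    (φ : MinFactorization 𝔄 T) : ℝ :=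
  letI := φ.instZ₁
  letI := φ.instZ₂
  letI := φ.instZ₃
  letI := φ.instW₁
  letI := φ.instW₂
  letI := φ.instW₃
  ‖φ.A‖ * 𝔄.nrm φ.Z φ.W φ.S * ∏ i, ‖φ.B i‖

/-- The minimal kernel `𝔄^min`. -/
def min (𝔄 : MultClass n) : MultClass n where
  mem _ _ _ _ _ _ _ _ := {T | Nonempty (MinFactorization 𝔄 T)}
  nrm _ _ _ _ _ _ _ _ T := ⨅ φ : MinFactorization 𝔄 T, φ.cost

/-- An ideal is minimal if it coincides isometrically with its minimal kernel. -/
def IsMinimal (𝔄 : MultClass n) : Prop :=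
  ∀ (X : Fin n → Type) (Y : Type)
    [∀ i, NormedAddCommGroup (X i)] [∀ i, NormedSpace ℂ (X i)] [∀ i, CompleteSpace (X i)]
    [NormedAddCommGroup Y] [NormedSpace ℂ Y] [CompleteSpace Y],
    𝔄.mem X Y = 𝔄.min.mem X Y ∧ ∀ T ∈ 𝔄.mem X Y, 𝔄.nrm X Y T = 𝔄.min.nrm X Y T

end MultClass

/-! ### Diagonal operators and the associated sequence space -/

/-- `T : E × ⋯ × E → F` is the diagonal operator `T(x₁, …, xₙ) = α · x₁ ⋯ xₙ`. -/
def IsDiagonal {n : ℕ} {E F : KotheSpace} (α : ℕ → ℂ)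
    (T : ContinuousMultilinearMap ℂ (fun _ : Fin n => E.Elem) F.Elem) : Prop :=
  ∀ (x : Fin n → E.Elem) (k : ℕ), (T x).seq k = α k * ∏ i, (x i).seq k

open Classical in
/-- The diagonal operator `T_α` (which is unique if it exists; zero if it does not exist). -/
def diagOp (n : ℕ) (E F : KotheSpace) (α : ℕ → ℂ) :
    ContinuousMultilinearMap ℂ (fun _ : Fin n => E.Elem) F.Elem :=
  if h : ∃ T : ContinuousMultilinearMap ℂ (fun _ : Fin n => E.Elem) F.Elem, IsDiagonal α T
  then h.choose else 0

/-- The sequence space `ℓ_n(𝔄; E, F)`: the bounded sequences `α` for which the diagonal operator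
`T_α` exists and belongs to `𝔄`, with the norm `‖T_α‖_𝔄`. -/
def ellN {n : ℕ} (𝔄 : MultClass n) (E F : KotheSpace) : SeqSpace where
  carrier := {α | (∃ C : ℝ, ∀ k, ‖α k‖ ≤ C) ∧
    IsDiagonal α (diagOp n E F α) ∧ diagOp n E F α ∈ 𝔄.mem (fun _ => E.Elem) F.Elem}
  nrm α := 𝔄.nrm (fun _ => E.Elem) F.Elem (diagOp n E F α)

end

/-! The ideal norm dominates the operator norm, so limits in `𝔄` are pointwise limits, and pointwise
limits of diagonal operators are diagonal. Hence `ℓ_n(𝔄; E, F)` inherits completeness from `𝔄`.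
Normality holds because a bounded multiplier can be absorbed into an operator on `F`. The space `ℓ₁`
is contained in it because `∑ x_k T_{e_k}` converges absolutely in `𝔄`.

The core is (ii), proved by converting factorizations into each other. If `α = y · z` with `z` null,
let `r` be an `(n + 1)`-st root of `z`. Then `T_α = M_r ∘ T_y ∘ (M_r, …, M_r)`, where multiplication
by the null sequence `r` is approximable and maps `F` into `F^min`; the cost is at most `‖y‖ ‖z‖_∞`
(`exists_minFactorization_mul`).

Conversely, let `T_α = A ∘ S ∘ (B₁, …, Bₙ)` with `A` approximable into `F^min`. The tail operators
tend to zero pointwise on `F^min`, hence in norm after composition with `A`. Adding to `A` a sparse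
sequence of its tails yields `A' = c · A` with `c → ∞` and `‖A'‖ ≤ ‖A‖ + ε` (`factor_approximable`).
So `c · α` belongs to `ℓ_n(𝔄; E, F)`, and `α = (c · α) · (1 / c)`
(`exists_mul_of_minFactorization`). Part (i) is (ii) with `F` in place of `F^min` and `𝔄` in place
of `𝔄^min`. -/

noncomputable section

/-! ### Unit vectors and multiplication operators -/

namespace KotheSpace

theorem Elem.ext {E : KotheSpace} {x y : E.Elem} (h : ∀ k, x.seq k = y.seq k) : x = y :=
  Subtype.ext (funext h)

theorem Elem.seq_smul {E : KotheSpace} (c : ℂ) (x : E.Elem) : (c • x).seq = c • x.seq := rfl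

theorem coord_apply (E : KotheSpace) (k : ℕ) (x : E.Elem) : E.coord k x = x.seq k := rfl

theorem norm_coord_le (E : KotheSpace) (k : ℕ) : ‖E.coord k‖ ≤ 1 :=
  LinearMap.mkContinuous_norm_le _ zero_le_one _

theorem summable_norm_single (k : ℕ) (c : ℂ) :
    Summable fun j => ‖(Pi.single k c : ℕ → ℂ) j‖ := by
  apply summable_of_ne_finset_zero (s := {k})
  intro j hj
  have : j ≠ k := by simpa using hj
  simp [this]

/-- The unit vector `e_k`. -/
def basisVec (E : KotheSpace) (k : ℕ) : E.Elem :=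
  Elem.mk (Pi.single k 1) (E.isKothe.l1_mem _ (summable_norm_single k 1))

theorem basisVec_seq (E : KotheSpace) (k : ℕ) : (E.basisVec k).seq = Pi.single k 1 := rfl

theorem norm_basisVec_le (E : KotheSpace) (k : ℕ) : ‖E.basisVec k‖ ≤ 1 := by
  refine (E.isKothe.nrm_le_l1 _ (summable_norm_single k 1)).trans ?_
  rw [tsum_eq_single k]
  · simp
  · intro j hj
    simp [hj]

/-- Multiplication by the sequence `m`, as an operator between Köthe sequence spaces. -/
def mulOp (E F : KotheSpace) (m : ℕ → ℂ) (C : ℝ)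
    (h : ∀ x ∈ E.carrier, m * x ∈ F.carrier ∧ F.nrm (m * x) ≤ C * E.nrm x) :
    E.Elem →L[ℂ] F.Elem :=
  LinearMap.mkContinuous
    { toFun := fun x => Elem.mk (m * x.seq) (h x.seq x.mem).1
      map_add' := fun x y => Elem.ext fun k => mul_add (m k) (x.seq k) (y.seq k)
      map_smul' := fun c x => Elem.ext fun k => mul_left_comm (m k) c (x.seq k) } C
    (fun x => (h x.seq x.mem).2)

section mulOp

variable {E F : KotheSpace} {m : ℕ → ℂ} {C : ℝ}

theorem mulOp_seq (h : ∀ x ∈ E.carrier, m * x ∈ F.carrier ∧ F.nrm (m * x) ≤ C * E.nrm x)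
    (x : E.Elem) (k : ℕ) : (mulOp E F m C h x).seq k = m k * x.seq k := rfl

theorem norm_mulOp_le (h : ∀ x ∈ E.carrier, m * x ∈ F.carrier ∧ F.nrm (m * x) ≤ C * E.nrm x)
    (hC : 0 ≤ C) : ‖mulOp E F m C h‖ ≤ C :=
  LinearMap.mkContinuous_norm_le _ hC _

theorem mul_bound (E : KotheSpace) (hm : ∀ k, ‖m k‖ ≤ C) (x : ℕ → ℂ) (hx : x ∈ E.carrier) :
    m * x ∈ E.carrier ∧ E.nrm (m * x) ≤ C * E.nrm x := by
  refine E.mul_mem_of_bound hx ((norm_nonneg _).trans (hm 0)) fun k => ?_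
  rw [Pi.mul_apply, norm_mul]
  gcongr
  exact hm k

/-- An operator between Köthe spaces that annihilates all but finitely many coordinates of its
values has finite rank. -/
theorem finiteDimensional_range_of_seq_eq_zero {W : Type} [NormedAddCommGroup W]
    [NormedSpace ℂ W] (R : W →L[ℂ] F.Elem) (N : ℕ) (hR : ∀ w k, N ≤ k → (R w).seq k = 0) :
    FiniteDimensional ℂ (LinearMap.range (R : W →ₗ[ℂ] F.Elem)) := by
  classical
  let s : Finset F.Elem := (Finset.range N).image F.basisVec
  refine Submodule.finiteDimensional_of_le (S₂ := Submodule.span ℂ (s : Set F.Elem)) ?_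
  rintro _ ⟨w, rfl⟩
  have hw : R w = ∑ k ∈ Finset.range N, (R w).seq k • F.basisVec k := by
    apply Elem.ext
    intro j
    rw [← coord_apply F j (∑ k ∈ Finset.range N, _), map_sum]
    simp only [map_smul, coord_apply, basisVec_seq, smul_eq_mul, Pi.single_apply, mul_ite,
      mul_one, mul_zero]
    rw [Finset.sum_ite_eq]
    split_ifs with h
    · rfl
    · exact hR w j (by simpa using h)
  rw [ContinuousLinearMap.coe_coe, hw]
  refine Submodule.sum_mem _ fun k hk => Submodule.smul_mem _ _ (Submodule.subset_span ?_)
  exact Finset.mem_coe.2 (Finset.mem_image_of_mem _ hk)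

/-- Multiplication by a null sequence, if it has the obvious bounds, is approximable. -/
theorem isApproximable_mulOp
    (hmul : ∀ (m : ℕ → ℂ) (C : ℝ), Tendsto m atTop (𝓝 0) → (∀ k, ‖m k‖ ≤ C) →
      ∀ x ∈ E.carrier, m * x ∈ F.carrier ∧ F.nrm (m * x) ≤ C * E.nrm x)
    (hm : Tendsto m atTop (𝓝 0)) (hC : ∀ k, ‖m k‖ ≤ C) :
    IsApproximable (mulOp E F m C (hmul m C hm hC)) := by
  rw [IsApproximable, Metric.mem_closure_iff]
  intro ε hε
  obtain ⟨N, hN⟩ := Metric.tendsto_atTop.1 hm (ε / 2) (by positivity)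
  have ht : ∀ k, ‖tail N m k‖ ≤ ε / 2 := by
    intro k
    unfold tail
    split_ifs with h
    · have := hN k h
      rw [dist_zero_right] at this
      exact this.le
    · simp only [norm_zero]
      positivity
  have ht0 : Tendsto (tail N m) atTop (𝓝 0) :=
    squeeze_zero_norm (norm_tail_le N m) (by simpa using hm.norm)
  -- Removing `Q` leaves multiplication by a finitely supported sequence, and the error is `Q`
  -- itself. This is why `hmul` is assumed for all null multipliers: it is applied to the tail of
  -- `m` as well.
  let Q := mulOp E F (tail N m) (ε / 2) (hmul _ _ ht0 ht)
  refine ⟨mulOp E F m C (hmul m C hm hC) - Q, ?_, ?_⟩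
  · refine finiteDimensional_range_of_seq_eq_zero _ N fun x k hk => ?_
    change m k * x.seq k - tail N m k * x.seq k = 0
    simp [tail, hk]
  · rw [dist_eq_norm, sub_sub_cancel]
    exact (norm_mulOp_le _ (by positivity)).trans_lt (by linarith)

/-- The tails of `m · x` vanish because `m` is null, and on the minimal kernel both norms agree.
This supplies the hypothesis of `isApproximable_mulOp` for multipliers from `F` to `F^min`. -/
theorem mul_mem_min (F : KotheSpace) (m : ℕ → ℂ) (C : ℝ) (hm : Tendsto m atTop (𝓝 0))
    (hC : ∀ k, ‖m k‖ ≤ C) (x : ℕ → ℂ) (hx : x ∈ F.carrier) :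
    m * x ∈ F.min.carrier ∧ F.min.nrm (m * x) ≤ C * F.nrm x := by
  have hb := F.mul_bound hC x hx
  have hmem : m * x ∈ F.toSeqSpace.minKernel.carrier := by
    rw [mem_minKernel_iff, mul_comm]
    rw [mul_comm] at hb
    exact ⟨hb.1, F.tail_tendsto_of_mul hx hm⟩
  refine ⟨hmem, ?_⟩
  change F.toSeqSpace.minKernel.nrm (m * x) ≤ _
  rw [F.minKernel_nrm hmem]
  exact hb.2

end mulOp

/-! ### Tail operators and approximable operators into a minimal kernel -/

/-- The inclusion of the minimal kernel, of norm at most one. -/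
def minIncl (F : KotheSpace) : F.min.Elem →L[ℂ] F.Elem :=
  mulOp F.min F 1 1 fun x hx => by
    rw [one_mul, one_mul]
    exact ⟨((F.mem_minKernel_iff x).1 hx).1, (F.minKernel_nrm hx).ge⟩

theorem minIncl_seq (F : KotheSpace) (x : F.min.Elem) (k : ℕ) :
    (F.minIncl x).seq k = x.seq k := one_mul _

theorem norm_minIncl_le (F : KotheSpace) : ‖F.minIncl‖ ≤ 1 := norm_mulOp_le _ zero_le_one

/-- The operator that replaces the first `N` coordinates by zero. -/
def tailOp (E : KotheSpace) (N : ℕ) : E.Elem →L[ℂ] E.Elem :=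
  mulOp E E (tail N 1) 1 (E.mul_bound fun k => (norm_tail_le N 1 k).trans (by simp))

theorem tailOp_apply (E : KotheSpace) (N : ℕ) (x : E.Elem) :
    (E.tailOp N x).seq = tail N x.seq := by
  funext k
  change tail N 1 k * x.seq k = _
  simp only [tail, Pi.one_apply]
  split_ifs <;> simp

theorem norm_tailOp_le (E : KotheSpace) (N : ℕ) : ‖E.tailOp N‖ ≤ 1 :=
  norm_mulOp_le _ zero_le_one

theorem tendsto_tailOp_min (F : KotheSpace) (x : F.min.Elem) :
    Tendsto (fun N => F.min.tailOp N x) atTop (𝓝 0) := by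
  rw [tendsto_zero_iff_norm_tendsto_zero]
  have hx := ((F.mem_minKernel_iff x.seq).1 x.mem).2
  refine hx.congr fun N => ?_
  rw [Elem.norm_def, tailOp_apply]
  exact (F.minKernel_nrm (F.min.tail_mem x.mem N)).symm

variable {W : Type} [NormedAddCommGroup W] [NormedSpace ℂ W]

/-- Expanding `R` in a basis of its range writes it as a finite sum of rank-one operators, so
convergence of the tails at the finitely many basis vectors gives convergence in norm. -/
theorem tendsto_tailOp_comp_of_finiteRank (F : KotheSpace) (R : W →L[ℂ] F.min.Elem)
    (hR : FiniteDimensional ℂ (LinearMap.range (R : W →ₗ[ℂ] F.min.Elem))) :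
    Tendsto (fun N => (F.min.tailOp N).comp R) atTop (𝓝 0) := by
  let V := LinearMap.range (R : W →ₗ[ℂ] F.min.Elem)
  let b := Module.finBasis ℂ V
  let R' : W →L[ℂ] V := R.codRestrict V fun w => ⟨w, rfl⟩
  let φ : Fin (Module.finrank ℂ V) → W →L[ℂ] ℂ := fun i =>
    (LinearMap.toContinuousLinearMap (b.coord i)).comp R'
  have hsum : ∀ N, (F.min.tailOp N).comp R =
      ∑ i, (φ i).smulRight (F.min.tailOp N (b i : F.min.Elem)) := by
    intro N
    ext1 w
    have h1 : R w = ∑ i, φ i w • (b i : F.min.Elem) := by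
      have := congrArg (Subtype.val) (b.sum_repr (R' w))
      rw [Submodule.coe_sum] at this
      exact this.symm
    rw [ContinuousLinearMap.comp_apply, h1, map_sum]
    simp
  simp only [hsum]
  rw [← Finset.sum_const_zero (s := (Finset.univ : Finset (Fin (Module.finrank ℂ V))))]
  refine tendsto_finsetSum _ fun i _ => ?_
  rw [tendsto_zero_iff_norm_tendsto_zero]
  simp only [ContinuousLinearMap.norm_smulRight_apply]
  simpa using (F.tendsto_tailOp_min (b i)).norm.const_mul ‖φ i‖

/-- The tail operators are contractions, so an approximation of `A` by a finite rank operator stays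
equally good after composition. -/
theorem tendsto_tailOp_comp (F : KotheSpace) {A : W →L[ℂ] F.min.Elem} (hA : IsApproximable A) :
    Tendsto (fun N => (F.min.tailOp N).comp A) atTop (𝓝 0) := by
  rw [Metric.tendsto_atTop]
  intro ε hε
  obtain ⟨R, hR, hAR⟩ := Metric.mem_closure_iff.1 hA (ε / 2) (by positivity)
  obtain ⟨N, hN⟩ := Metric.tendsto_atTop.1 (F.tendsto_tailOp_comp_of_finiteRank R hR) (ε / 2)
    (by positivity)
  refine ⟨N, fun M hM => ?_⟩
  have h1 := hN M hM
  rw [dist_zero_right] at h1 ⊢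
  rw [dist_eq_norm] at hAR
  have h2 : (F.min.tailOp M).comp A = (F.min.tailOp M).comp (A - R) + (F.min.tailOp M).comp R := by
    rw [← ContinuousLinearMap.comp_add, sub_add_cancel]
  have h3 : ‖(F.min.tailOp M).comp (A - R)‖ ≤ ‖A - R‖ :=
    (ContinuousLinearMap.opNorm_comp_le _ _).trans
      (mul_le_of_le_one_left (norm_nonneg _) (F.min.norm_tailOp_le M))
  rw [h2]
  exact (norm_add_le _ _).trans_lt (by linarith)

/-- An approximable operator `A` into a minimal kernel factors, with almost the same norm, through
multiplication by a null sequence; the sequence is `1 / c`, and `A'` satisfies `A' = c · A`. -/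
theorem factor_approximable (F : KotheSpace) {A : W →L[ℂ] F.min.Elem} (hA : IsApproximable A)
    {ε : ℝ} (hε : 0 < ε) :
    ∃ (A' : W →L[ℂ] F.min.Elem) (c : ℕ → ℕ), ‖A'‖ ≤ ‖A‖ + ε ∧ Tendsto c atTop atTop ∧
      (∀ j, 1 ≤ c j) ∧ ∀ w j, (A' w).seq j = c j * (A w).seq j := by
  have ht := (F.tendsto_tailOp_comp hA).norm
  rw [norm_zero] at ht
  -- The bounds sum to `ε`. The requirement `k ≤ N k` ensures that only finitely many of the chosen
  -- tails involve a given coordinate.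
  have hch : ∀ k : ℕ, ∃ N, k ≤ N ∧ ‖(F.min.tailOp N).comp A‖ ≤ ε / 2 / 2 ^ k := by
    intro k
    have h1 := ht.eventually (gt_mem_nhds (show 0 < ε / 2 / 2 ^ k by positivity))
    obtain ⟨N, h2, h3⟩ := ((eventually_ge_atTop k).and h1).exists
    exact ⟨N, h2, h3.le⟩
  choose N hkN hN using hch
  let v : ℕ → W →L[ℂ] F.min.Elem := fun k => (F.min.tailOp (N k)).comp A
  have hsum : HasSum (fun k : ℕ => ε / 2 / 2 ^ k) ε := hasSum_geometric_two' ε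
  have hvs : Summable v := Summable.of_norm_bounded hsum.summable hN
  -- Coordinate `j` is contributed once by `A` and once by every tail with `N k ≤ j`; such `k`
  -- satisfy `k ≤ N k ≤ j`, so the count is over `range (j + 1)`.
  let c : ℕ → ℕ := fun j => 1 + ((Finset.range (j + 1)).filter fun k => N k ≤ j).card
  refine ⟨A + ∑' k, v k, c, ?_, ?_, fun j => Nat.le_add_right 1 _, ?_⟩
  · have h1 : ‖∑' k, v k‖ ≤ ε := tsum_of_norm_bounded hsum hN
    exact (norm_add_le _ _).trans (by gcongr)
  · rw [tendsto_atTop]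
    intro K
    -- Beyond the sum of the first `K` cut-off points, all of the first `K` tails are counted.
    refine (eventually_ge_atTop (∑ k ∈ Finset.range K, N k)).mono fun j hj => ?_
    have hsub : Finset.range K ⊆ (Finset.range (j + 1)).filter fun k => N k ≤ j := by
      intro k hk
      have h1 : N k ≤ j :=
        (Finset.single_le_sum (f := N) (fun _ _ => Nat.zero_le _) hk).trans hj
      exact Finset.mem_filter.2
        ⟨Finset.mem_range.2 (Nat.lt_succ_of_le ((hkN k).trans h1)), h1⟩
    have := Finset.card_le_card hsub
    rw [Finset.card_range] at this
    simp only [c]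
    omega
  · intro w j
    let ev : (W →L[ℂ] F.min.Elem) →L[ℂ] ℂ :=
      (F.min.coord j).comp (ContinuousLinearMap.apply ℂ F.min.Elem w)
    have h1 : ((A + ∑' k, v k) w).seq j = (A w).seq j + ev (∑' k, v k) := rfl
    have h2 : ∀ k, ev (v k) = if N k ≤ j then (A w).seq j else 0 := fun k => by
      change (F.min.tailOp (N k) (A w)).seq j = _
      rw [tailOp_apply, tail]
    rw [h1, ev.map_tsum hvs]
    simp only [h2]
    rw [tsum_eq_sum (s := Finset.range (j + 1))]
    · rw [← Finset.sum_filter, Finset.sum_const, nsmul_eq_mul]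
      simp only [c]
      push_cast
      ring
    · intro k hk
      rw [if_neg]
      intro h
      exact hk (Finset.mem_range.2 (Nat.lt_succ_of_le ((hkN k).trans h)))

end KotheSpace

/-! ### Consequences of the ideal axioms -/

theorem sandwich_apply {n : ℕ} {X G : Fin n → Type} {Y H : Type}
    [∀ i, NormedAddCommGroup (X i)] [∀ i, NormedSpace ℂ (X i)]
    [∀ i, NormedAddCommGroup (G i)] [∀ i, NormedSpace ℂ (G i)]
    [NormedAddCommGroup Y] [NormedSpace ℂ Y] [NormedAddCommGroup H] [NormedSpace ℂ H]
    (A : Y →L[ℂ] H) (T : ContinuousMultilinearMap ℂ X Y) (B : ∀ i, G i →L[ℂ] X i)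
    (x : ∀ i, G i) : sandwich A T B x = A (T fun i => B i (x i)) := rfl

theorem rankOne_apply {n : ℕ} {X : Fin n → Type} {Y : Type}
    [∀ i, NormedAddCommGroup (X i)] [∀ i, NormedSpace ℂ (X i)]
    [NormedAddCommGroup Y] [NormedSpace ℂ Y]
    (γ : ∀ i, X i →L[ℂ] ℂ) (f : Y) (x : ∀ i, X i) :
    rankOne γ f x = (∏ i, γ i (x i)) • f := by
  simp [rankOne]

namespace MultClass.IsNormedIdeal

variable {n : ℕ} {𝔄 : MultClass n} {X : Fin n → Type} {Y : Type}
  [∀ i, NormedAddCommGroup (X i)] [∀ i, NormedSpace ℂ (X i)] [∀ i, CompleteSpace (X i)]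
  [NormedAddCommGroup Y] [NormedSpace ℂ Y] [CompleteSpace Y]

theorem smul_mem (h : 𝔄.IsNormedIdeal) (c : ℂ) {T : ContinuousMultilinearMap ℂ X Y}
    (hT : T ∈ 𝔄.mem X Y) : c • T ∈ 𝔄.mem X Y := by
  have h1 := h.sandwich_mem X X Y Y T hT (c • ContinuousLinearMap.id ℂ Y)
    fun i => ContinuousLinearMap.id ℂ (X i)
  have h2 : c • T = sandwich (c • ContinuousLinearMap.id ℂ Y) T
      (fun i => ContinuousLinearMap.id ℂ (X i)) := by
    ext1 x
    rfl
  rwa [h2]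

theorem sub_mem (h : 𝔄.IsNormedIdeal) {S T : ContinuousMultilinearMap ℂ X Y}
    (hS : S ∈ 𝔄.mem X Y) (hT : T ∈ 𝔄.mem X Y) : S - T ∈ 𝔄.mem X Y := by
  have h1 := h.add_mem X Y S hS _ (h.smul_mem (-1) hT)
  rwa [neg_one_smul, ← sub_eq_add_neg] at h1

theorem zero_mem (h : 𝔄.IsNormedIdeal) : (0 : ContinuousMultilinearMap ℂ X Y) ∈ 𝔄.mem X Y := by
  have h1 := h.smul_mem 0 (h.rankOne_mem X Y 0 0)
  rwa [zero_smul] at h1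

theorem nrm_zero (h : 𝔄.IsNormedIdeal) : 𝔄.nrm X Y 0 = 0 := by
  have h1 := h.nrm_smul X Y 0 0 h.zero_mem
  simpa using h1

theorem nrm_sub_comm (h : 𝔄.IsNormedIdeal) {S T : ContinuousMultilinearMap ℂ X Y}
    (hS : S ∈ 𝔄.mem X Y) (hT : T ∈ 𝔄.mem X Y) : 𝔄.nrm X Y (S - T) = 𝔄.nrm X Y (T - S) := by
  have h1 := h.nrm_smul X Y (-1) _ (h.sub_mem hT hS)
  rwa [neg_one_smul, neg_sub, norm_neg, norm_one, one_mul] at h1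

theorem nrm_nonneg (h : 𝔄.IsNormedIdeal) {T : ContinuousMultilinearMap ℂ X Y}
    (hT : T ∈ 𝔄.mem X Y) : 0 ≤ 𝔄.nrm X Y T := by
  have h1 := h.nrm_add_le X Y T hT _ (h.smul_mem (-1) hT)
  -- The triangle inequality for `T + (-T)` reads `0 ≤ 2 ‖T‖`.
  rw [h.nrm_smul X Y _ T hT, neg_one_smul, add_neg_cancel, h.nrm_zero, norm_neg, norm_one] at h1
  linarith

/-- The ideal norm dominates the operator norm. -/
theorem norm_apply_le (h : 𝔄.IsNormedIdeal) {T : ContinuousMultilinearMap ℂ X Y}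
    (hT : T ∈ 𝔄.mem X Y) (x : ∀ i, X i) : ‖T x‖ ≤ 𝔄.nrm X Y T * ∏ i, ‖x i‖ := by
  obtain ⟨φ, hφ, hφx⟩ := exists_dual_vector'' ℂ (T x)
  have h1 := h.nrm_sandwich_le X (fun _ => ℂ) Y ℂ T hT φ
    fun i => ContinuousLinearMap.toSpanSingleton ℂ (x i)
  -- Restricting `T` to the lines through the `x i` and composing with a norming functional gives a
  -- scalar rank-one operator, whose ideal norm is `|φ (T x)| = ‖T x‖`.
  have h2 : sandwich φ T (fun i => ContinuousLinearMap.toSpanSingleton ℂ (x i)) =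
      rankOne (fun _ => ContinuousLinearMap.id ℂ ℂ) (φ (T x)) := by
    ext
    rw [sandwich_apply, rankOne_apply]
    simp only [ContinuousLinearMap.toSpanSingleton_apply, ContinuousLinearMap.id_apply]
    rw [T.map_smul_univ, map_smul]
  rw [h2, h.nrm_rankOne, hφx] at h1
  simp only [ContinuousLinearMap.norm_id, Finset.prod_const_one, one_mul,
    ContinuousLinearMap.norm_toSpanSingleton] at h1
  have h3 : ‖((‖T x‖ : ℝ) : ℂ)‖ = ‖T x‖ := by simp
  refine h3.symm.le.trans (h1.trans ?_)
  have h4 := h.nrm_nonneg hT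
  have h5 : (0 : ℝ) ≤ ∏ i, ‖x i‖ := Finset.prod_nonneg fun _ _ => norm_nonneg _
  gcongr
  exact mul_le_of_le_one_left h4 hφ

theorem tendsto_apply (h : 𝔄.IsNormedIdeal) {u : ℕ → ContinuousMultilinearMap ℂ X Y}
    {T : ContinuousMultilinearMap ℂ X Y} (hu : ∀ m, u m ∈ 𝔄.mem X Y) (hT : T ∈ 𝔄.mem X Y)
    (hlim : Tendsto (fun m => 𝔄.nrm X Y (u m - T)) atTop (𝓝 0)) (x : ∀ i, X i) :
    Tendsto (fun m => u m x) atTop (𝓝 (T x)) := by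
  rw [tendsto_iff_norm_sub_tendsto_zero]
  refine squeeze_zero (fun _ => norm_nonneg _)
    (fun m => h.norm_apply_le (h.sub_mem (hu m) hT) x) ?_
  simpa using hlim.mul_const (∏ i, ‖x i‖)

end MultClass.IsNormedIdeal

/-! ### Diagonal operators and their symbols -/

section diagonal

variable {n : ℕ} {E F : KotheSpace} {α β : ℕ → ℂ}
  {S T : ContinuousMultilinearMap ℂ (fun _ : Fin n => E.Elem) F.Elem}

theorem IsDiagonal.unique (hS : IsDiagonal α S) (hT : IsDiagonal α T) : S = T := by
  ext1 x
  exact KotheSpace.Elem.ext fun k => (hS x k).trans (hT x k).symm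

theorem IsDiagonal.diagOp_eq (hT : IsDiagonal α T) : diagOp n E F α = T := by
  have h : ∃ T : ContinuousMultilinearMap ℂ (fun _ : Fin n => E.Elem) F.Elem, IsDiagonal α T :=
    ⟨T, hT⟩
  rw [diagOp, dif_pos h]
  exact h.choose_spec.unique hT

theorem IsDiagonal.add (hS : IsDiagonal α S) (hT : IsDiagonal β T) :
    IsDiagonal (α + β) (S + T) := by
  intro x k
  change (S x).seq k + (T x).seq k = (α k + β k) * _
  rw [hS, hT, add_mul]

theorem IsDiagonal.smul (c : ℂ) (hT : IsDiagonal α T) : IsDiagonal (c • α) (c • T) := by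
  intro x k
  change c * (T x).seq k = c * α k * _
  rw [hT, mul_assoc]

theorem IsDiagonal.sub (hS : IsDiagonal α S) (hT : IsDiagonal β T) :
    IsDiagonal (α - β) (S - T) := by
  have h := hS.add (hT.smul (-1))
  rwa [neg_one_smul, neg_one_smul, ← sub_eq_add_neg, ← sub_eq_add_neg] at h

theorem IsDiagonal.apply_basisVec (hT : IsDiagonal α T) (k : ℕ) :
    (T fun _ => E.basisVec k).seq k = α k := by
  rw [hT]
  simp [KotheSpace.basisVec_seq]

theorem prod_norm_basisVec_le (n : ℕ) (E : KotheSpace) (k : ℕ) :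
    ∏ _i : Fin n, ‖E.basisVec k‖ ≤ 1 :=
  Finset.prod_le_one (fun _ _ => norm_nonneg _) fun _ _ => E.norm_basisVec_le k

theorem IsDiagonal.norm_le (hT : IsDiagonal α T) {C : ℝ} (hC : 0 ≤ C)
    (hTC : ∀ x, ‖T x‖ ≤ C * ∏ i, ‖x i‖) (k : ℕ) : ‖α k‖ ≤ C := by
  rw [← hT.apply_basisVec k]
  exact (F.isKothe.coord_le _ (KotheSpace.Elem.mem _) k).trans
    ((hTC _).trans (mul_le_of_le_one_right hC (prod_norm_basisVec_le n E k)))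

/-- Post-composition with an operator that multiplies coordinates. -/
theorem IsDiagonal.sandwich {G H : KotheSpace} (hT : IsDiagonal α T) {A : F.Elem →L[ℂ] H.Elem}
    {B : Fin n → G.Elem →L[ℂ] E.Elem} {a b : ℕ → ℂ}
    (hA : ∀ y k, (A y).seq k = a k * y.seq k) (hB : ∀ i x k, (B i x).seq k = b k * x.seq k) :
    IsDiagonal (fun k => a k * α k * b k ^ n) (sandwich A T B) := by
  intro x k
  rw [sandwich_apply, hA, hT]
  simp only [hB, Finset.prod_mul_distrib, Finset.prod_const, Finset.card_univ, Fintype.card_fin]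
  ring

/-- Testing on unit vectors gives `|α k| ≤ ‖T‖`, so the boundedness required in the definition is
automatic; uniqueness of the diagonal operator allows any witness in place of `diagOp`. -/
theorem mem_ellN_iff (𝔄 : MultClass n) : α ∈ (ellN 𝔄 E F).carrier ↔
    ∃ T ∈ 𝔄.mem (fun _ => E.Elem) F.Elem, IsDiagonal α T := by
  constructor
  · rintro ⟨-, h1, h2⟩
    exact ⟨_, h2, h1⟩
  · rintro ⟨T, hT, hα⟩
    refine ⟨⟨‖T‖, hα.norm_le (norm_nonneg _) T.le_opNorm⟩, ?_⟩
    rw [hα.diagOp_eq]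
    exact ⟨hα, hT⟩

theorem IsDiagonal.ellN_nrm (𝔄 : MultClass n) (hT : IsDiagonal α T) :
    (ellN 𝔄 E F).nrm α = 𝔄.nrm (fun _ => E.Elem) F.Elem T := by
  rw [← hT.diagOp_eq]
  rfl

/-- Coordinates are continuous, so the diagonal identity passes to the limit; the limit symbol is
read off on the unit vectors. -/
theorem isDiagonal_of_tendsto {u : ℕ → ContinuousMultilinearMap ℂ (fun _ : Fin n => E.Elem) F.Elem}
    {a : ℕ → ℕ → ℂ} (hu : ∀ m, IsDiagonal (a m) (u m))
    (hlim : ∀ x, Tendsto (fun m => u m x) atTop (𝓝 (T x))) :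
    IsDiagonal (fun k => (T fun _ => E.basisVec k).seq k) T ∧
      ∀ k, Tendsto (fun m => a m k) atTop (𝓝 ((T fun _ => E.basisVec k).seq k)) := by
  have hseq : ∀ x k, Tendsto (fun m => (u m x).seq k) atTop (𝓝 ((T x).seq k)) := fun x k =>
    ((F.coord k).continuous.tendsto _).comp (hlim x)
  have ha : ∀ k, Tendsto (fun m => a m k) atTop (𝓝 ((T fun _ => E.basisVec k).seq k)) :=
    fun k => (hseq _ k).congr fun m => (hu m).apply_basisVec k
  refine ⟨fun x k => tendsto_nhds_unique (hseq x k) ?_, ha⟩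
  simp only [hu _ x k]
  exact (ha k).mul_const _

theorem isDiagonal_rankOne (n : ℕ) (E F : KotheSpace) (k : ℕ) :
    IsDiagonal (Pi.single k 1) (rankOne (fun _ : Fin n => E.coord k) (F.basisVec k)) := by
  intro x j
  rw [rankOne_apply, KotheSpace.Elem.seq_smul, Pi.smul_apply, KotheSpace.basisVec_seq]
  by_cases h : j = k
  · subst h
    simp [KotheSpace.coord_apply]
  · simp [h]

end diagonal

/-! ### The space `ℓ_n(𝔄; E, F)` is a Köthe sequence space -/

namespace MultClass

variable {n : ℕ} {𝔄 : MultClass n} {E F : KotheSpace}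

/-- A multiplier from `F` to `H` of norm at most one is a multiplier from `ℓ_n(𝔄; E, F)` to
`ℓ_n(𝔄; E, H)` of norm at most one. -/
theorem IsNormedIdeal.ellN_mul (h : 𝔄.IsNormedIdeal) {H : KotheSpace} {m y : ℕ → ℂ}
    (hm : ∀ x ∈ F.carrier, m * x ∈ H.carrier ∧ H.nrm (m * x) ≤ 1 * F.nrm x)
    (hy : y ∈ (ellN 𝔄 E F).carrier) :
    m * y ∈ (ellN 𝔄 E H).carrier ∧ (ellN 𝔄 E H).nrm (m * y) ≤ (ellN 𝔄 E F).nrm y := by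
  obtain ⟨T, hT, hyT⟩ := (mem_ellN_iff 𝔄).1 hy
  let A := KotheSpace.mulOp F H m 1 hm
  have hA : ‖A‖ ≤ 1 := KotheSpace.norm_mulOp_le _ zero_le_one
  have hd := hyT.sandwich (A := A) (B := fun _ => ContinuousLinearMap.id ℂ E.Elem) (b := 1)
    (KotheSpace.mulOp_seq _) (fun i x k => (one_mul _).symm)
  have hmy : (fun k => m k * y k * (1 : ℕ → ℂ) k ^ n) = m * y := by
    funext k
    simp
  rw [hmy] at hd
  refine ⟨(mem_ellN_iff 𝔄).2 ⟨_, h.sandwich_mem _ _ _ _ T hT _ _, hd⟩, ?_⟩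
  rw [hd.ellN_nrm, hyT.ellN_nrm]
  refine (h.nrm_sandwich_le _ _ _ _ T hT _ _).trans ?_
  have h0 := h.nrm_nonneg hT
  have h1 : ∏ _i : Fin n, ‖ContinuousLinearMap.id ℂ E.Elem‖ ≤ 1 :=
    Finset.prod_le_one (fun _ _ => norm_nonneg _) fun _ _ => ContinuousLinearMap.norm_id_le
  calc ‖A‖ * 𝔄.nrm _ _ T * ∏ _i : Fin n, ‖ContinuousLinearMap.id ℂ E.Elem‖
      ≤ ‖A‖ * 𝔄.nrm _ _ T := mul_le_of_le_one_right (by positivity) h1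
    _ ≤ _ := mul_le_of_le_one_left h0 hA

/-- The quotient `x / y` is bounded by one and hence a contractive multiplier on `F`. Where `y`
vanishes so does `x`, and the convention `0 / 0 = 0` is harmless. -/
theorem IsNormedIdeal.ellN_normal (h : 𝔄.IsNormedIdeal) {x y : ℕ → ℂ}
    (hy : y ∈ (ellN 𝔄 E F).carrier) (hxy : ∀ k, ‖x k‖ ≤ ‖y k‖) :
    x ∈ (ellN 𝔄 E F).carrier ∧ (ellN 𝔄 E F).nrm x ≤ (ellN 𝔄 E F).nrm y := by
  have hm : ∀ k, ‖(x / y) k‖ ≤ 1 := fun k => by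
    rw [Pi.div_apply, norm_div]
    exact div_le_one_of_le₀ (hxy k) (norm_nonneg _)
  have hx : x / y * y = x := by
    funext k
    by_cases h0 : y k = 0
    · have := hxy k
      rw [h0, norm_zero, norm_le_zero_iff] at this
      simp [this]
    · simp [h0]
  have h1 := h.ellN_mul (F.mul_bound hm) hy
  rwa [hx] at h1

theorem IsNormedIdeal.nrm_rankOne_coord_le (h : 𝔄.IsNormedIdeal) (E F : KotheSpace) (k : ℕ) :
    𝔄.nrm _ _ (rankOne (fun _ : Fin n => E.coord k) (F.basisVec k)) ≤ 1 := by
  rw [h.nrm_rankOne]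
  exact mul_le_one₀ (Finset.prod_le_one (fun _ _ => norm_nonneg _) fun _ _ => E.norm_coord_le k)
    (norm_nonneg _) (F.norm_basisVec_le k)

/-- The operator `T_x` is the sum of the rank-one diagonal operators `x_k T_{e_k}`, whose ideal
norms are at most `|x_k|`; completeness of `𝔄` provides the sum. -/
theorem IsBanachIdeal.ellN_l1 (h : 𝔄.IsBanachIdeal) {x : ℕ → ℂ}
    (hx : Summable fun k => ‖x k‖) :
    x ∈ (ellN 𝔄 E F).carrier ∧ (ellN 𝔄 E F).nrm x ≤ ∑' k, ‖x k‖ := by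
  have h' := h.toIsNormedIdeal
  let R : ℕ → ContinuousMultilinearMap ℂ (fun _ : Fin n => E.Elem) F.Elem := fun k =>
    rankOne (fun _ : Fin n => E.coord k) (F.basisVec k)
  have hR : ∀ k, x k • R k ∈ 𝔄.mem (fun _ => E.Elem) F.Elem := fun k =>
    h'.smul_mem _ (h'.rankOne_mem _ _ _ _)
  have hRn : ∀ k, 𝔄.nrm _ _ (x k • R k) ≤ ‖x k‖ := fun k => by
    rw [h'.nrm_smul _ _ _ _ (h'.rankOne_mem _ _ _ _)]
    exact mul_le_of_le_one_right (norm_nonneg _) (h'.nrm_rankOne_coord_le E F k)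
  let u : ℕ → ContinuousMultilinearMap ℂ (fun _ : Fin n => E.Elem) F.Elem := fun m =>
    ∑ k ∈ Finset.range m, x k • R k
  let s : ℕ → ℝ := fun m => ∑ k ∈ Finset.range m, ‖x k‖
  have hu_succ : ∀ m, u (m + 1) = u m + x m • R m := fun m => Finset.sum_range_succ _ _
  have hs_succ : ∀ m, s (m + 1) = s m + ‖x m‖ := fun m => Finset.sum_range_succ _ _
  have hu : ∀ m, u m ∈ 𝔄.mem (fun _ => E.Elem) F.Elem := by
    intro m
    induction m with
    | zero => exact h'.zero_mem
    | succ m ih => rw [hu_succ]; exact h'.add_mem _ _ _ ih _ (hR m)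
  have hdiff : ∀ l m, l ≤ m → 𝔄.nrm _ _ (u m - u l) ≤ s m - s l := by
    intro l m hlm
    induction m, hlm using Nat.le_induction with
    | base => rw [sub_self, h'.nrm_zero, sub_self]
    | succ m hm ih =>
      rw [hu_succ, add_sub_right_comm, hs_succ]
      refine (h'.nrm_add_le _ _ _ (h'.sub_mem (hu m) (hu l)) _ (hR m)).trans ?_
      linarith [hRn m]
  have hdist : ∀ m l, 𝔄.nrm _ _ (u m - u l) ≤ dist (s m) (s l) := by
    intro m l
    rw [Real.dist_eq]
    rcases le_total l m with hlm | hlm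
    · exact (hdiff l m hlm).trans (le_abs_self _)
    · rw [h'.nrm_sub_comm (hu m) (hu l), abs_sub_comm]
      exact (hdiff m l hlm).trans (le_abs_self _)
  have hslim : Tendsto s atTop (𝓝 (∑' k, ‖x k‖)) := hx.hasSum.tendsto_sum_nat
  have hsC := Metric.cauchySeq_iff.1 hslim.cauchySeq
  obtain ⟨T, hT, hlim⟩ := h.complete _ _ u hu fun ε hε => by
    obtain ⟨N, hN⟩ := hsC ε hε
    exact ⟨N, fun m hm l hl => (hdist m l).trans_lt (hN m hm l hl)⟩
  -- The symbol of the partial sum `u m` is `x` cut off at `m`, which is eventually equal to `x` in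
  -- each coordinate.
  let a : ℕ → ℕ → ℂ := fun m k => if k < m then x k else 0
  have hua : ∀ m, IsDiagonal (a m) (u m) := by
    intro m
    induction m with
    | zero =>
      intro y k
      change (0 : ℂ) = (if k < 0 then x k else 0) * _
      simp
    | succ m ih =>
      rw [hu_succ]
      convert ih.add ((isDiagonal_rankOne n E F m).smul (x m)) using 1
      funext k
      simp only [a, Pi.add_apply, Pi.smul_apply, Pi.single_apply, smul_eq_mul, mul_ite, mul_one,
        mul_zero]
      rcases lt_trichotomy k m with hk | hk | hk
      · simp [hk, hk.ne, hk.trans (Nat.lt_succ_self m)]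
      · simp [hk]
      · simp [hk.ne', hk.not_gt, show ¬ k < m + 1 by omega]
  obtain ⟨hd, hak⟩ := isDiagonal_of_tendsto hua (h'.tendsto_apply hu hT hlim)
  have hxeq : (fun k => (T fun _ => E.basisVec k).seq k) = x := by
    funext k
    refine tendsto_nhds_unique (hak k) (tendsto_const_nhds.congr' ?_)
    filter_upwards [eventually_gt_atTop k] with m hm
    simp [a, hm]
  rw [hxeq] at hd
  refine ⟨(mem_ellN_iff 𝔄).2 ⟨T, hT, hd⟩, ?_⟩
  rw [hd.ellN_nrm]
  have hle : ∀ m, 𝔄.nrm _ _ T ≤ 𝔄.nrm _ _ (u m - T) + s m := by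
    intro m
    have h1 := h'.nrm_add_le _ _ _ (h'.sub_mem hT (hu m)) _ (hu m)
    rw [sub_add_cancel, h'.nrm_sub_comm hT (hu m)] at h1
    have h2 := hdiff 0 m (Nat.zero_le m)
    have h3 : u m - u 0 = u m := sub_zero _
    have h4 : s 0 = 0 := Finset.sum_range_zero _
    rw [h3, h4, sub_zero] at h2
    linarith
  have := ge_of_tendsto' (hlim.add hslim) hle
  rwa [zero_add] at this

theorem IsBanachIdeal.ellN_isKothe (h : 𝔄.IsBanachIdeal) (E F : KotheSpace) :
    (ellN 𝔄 E F).IsKothe where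
  add_mem x hx y hy := by
    rw [mem_ellN_iff] at *
    obtain ⟨S, hS, hxS⟩ := hx
    obtain ⟨T, hT, hyT⟩ := hy
    exact ⟨_, h.add_mem _ _ S hS T hT, hxS.add hyT⟩
  smul_mem c x hx := by
    rw [mem_ellN_iff] at *
    obtain ⟨S, hS, hxS⟩ := hx
    exact ⟨_, h.toIsNormedIdeal.smul_mem c hS, hxS.smul c⟩
  nrm_add_le x hx y hy := by
    rw [mem_ellN_iff] at *
    obtain ⟨S, hS, hxS⟩ := hx
    obtain ⟨T, hT, hyT⟩ := hy
    rw [(hxS.add hyT).ellN_nrm, hxS.ellN_nrm, hyT.ellN_nrm]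
    exact h.nrm_add_le _ _ S hS T hT
  nrm_smul c x hx := by
    rw [mem_ellN_iff] at *
    obtain ⟨S, hS, hxS⟩ := hx
    rw [(hxS.smul c).ellN_nrm, hxS.ellN_nrm]
    exact h.nrm_smul _ _ c S hS
  l1_mem _ hx := (h.ellN_l1 hx).1
  nrm_le_l1 _ hx := (h.ellN_l1 hx).2
  coord_le x hx := by
    rw [mem_ellN_iff] at *
    obtain ⟨S, hS, hxS⟩ := hx
    rw [hxS.ellN_nrm]
    exact hxS.norm_le (h.toIsNormedIdeal.nrm_nonneg hS) (h.toIsNormedIdeal.norm_apply_le hS)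
  normal_mem _ _ hy hxy := (h.toIsNormedIdeal.ellN_normal hy hxy).1
  normal_nrm _ _ hy hxy := (h.toIsNormedIdeal.ellN_normal hy hxy).2
  complete u hu hC := by
    have h' := h.toIsNormedIdeal
    choose T hT huT using fun m => (mem_ellN_iff 𝔄).1 (hu m)
    obtain ⟨S, hS, hlim⟩ := h.complete _ _ T hT fun ε hε => by
      obtain ⟨N, hN⟩ := hC ε hε
      refine ⟨N, fun m hm l hl => ?_⟩
      rw [← ((huT m).sub (huT l)).ellN_nrm]
      exact hN m hm l hl
    -- The limit in `𝔄` is a pointwise limit, hence again diagonal.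
    obtain ⟨hd, -⟩ := isDiagonal_of_tendsto huT (h'.tendsto_apply hT hS hlim)
    refine ⟨_, (mem_ellN_iff 𝔄).2 ⟨S, hS, hd⟩, hlim.congr fun m => ?_⟩
    rw [((huT m).sub hd).ellN_nrm]

end MultClass

/-! ### The minimal kernel of `ℓ_n(𝔄; E, F)` -/

/-- A null sequence has a null sequence of `(n + 1)`-st roots. -/
theorem exists_root_tendsto_zero (n : ℕ) {z : ℕ → ℂ} (hz : Tendsto z atTop (𝓝 0)) :
    ∃ (r : ℕ → ℂ) (t : ℝ), Tendsto r atTop (𝓝 0) ∧ (∀ k, r k ^ (n + 1) = z k) ∧ 0 ≤ t ∧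
      (∀ k, ‖r k‖ ≤ t) ∧ t ^ (n + 1) = ⨆ k, ‖z k‖ := by
  have hn : n + 1 ≠ 0 := n.succ_ne_zero
  have hsup0 : 0 ≤ ⨆ k, ‖z k‖ := Real.iSup_nonneg fun k => norm_nonneg _
  have hr : ∀ k, (z k ^ (((n + 1 : ℕ) : ℂ)⁻¹)) ^ (n + 1) = z k := fun k =>
    Complex.cpow_nat_inv_pow _ hn
  have ht : ((⨆ k, ‖z k‖) ^ (((n + 1 : ℕ) : ℝ)⁻¹)) ^ (n + 1) = ⨆ k, ‖z k‖ :=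
    Real.rpow_inv_natCast_pow hsup0 hn
  refine ⟨fun k => z k ^ (((n + 1 : ℕ) : ℂ)⁻¹), (⨆ k, ‖z k‖) ^ (((n + 1 : ℕ) : ℝ)⁻¹), ?_, hr,
    Real.rpow_nonneg hsup0 _, fun k => ?_, ht⟩
  · have h1 : Tendsto (fun k => ‖z k‖ ^ (((n + 1 : ℕ) : ℝ)⁻¹)) atTop (𝓝 0) := by
      have h2 := hz.norm.rpow_const (p := ((n + 1 : ℕ) : ℝ)⁻¹) (Or.inr (by positivity))
      rwa [norm_zero, Real.zero_rpow (by positivity)] at h2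
    refine squeeze_zero_norm (fun k => ?_) h1
    -- Norms of roots are compared through their `(n + 1)`-st powers.
    refine le_of_pow_le_pow_left₀ hn (by positivity) ?_
    rw [← norm_pow, hr, Real.rpow_inv_natCast_pow (norm_nonneg _) hn]
  · refine le_of_pow_le_pow_left₀ hn (Real.rpow_nonneg hsup0 _) ?_
    rw [← norm_pow, hr, ht]
    exact le_ciSup (KotheSpace.bddAbove_of_tendsto hz) k

namespace MultClass

variable {n : ℕ} {𝔄 : MultClass n} {E F : KotheSpace}

theorem IsNormedIdeal.cost_nonneg (h : 𝔄.IsNormedIdeal) {X : Fin n → Type} {Y : Type}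
    [∀ i, NormedAddCommGroup (X i)] [∀ i, NormedSpace ℂ (X i)]
    [NormedAddCommGroup Y] [NormedSpace ℂ Y] {T : ContinuousMultilinearMap ℂ X Y}
    (φ : MinFactorization 𝔄 T) : 0 ≤ φ.cost := by
  let := φ.instZ₁
  let := φ.instZ₂
  let := φ.instZ₃
  let := φ.instW₁
  let := φ.instW₂
  let := φ.instW₃
  have h1 := h.nrm_nonneg φ.mem_S
  have h2 : 0 ≤ ∏ i, ‖φ.B i‖ := Finset.prod_nonneg fun _ _ => norm_nonneg _
  exact mul_nonneg (mul_nonneg (norm_nonneg _) h1) h2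

theorem IsNormedIdeal.min_nrm_le (h : 𝔄.IsNormedIdeal) {X : Fin n → Type} {Y : Type}
    [∀ i, NormedAddCommGroup (X i)] [∀ i, NormedSpace ℂ (X i)] [∀ i, CompleteSpace (X i)]
    [NormedAddCommGroup Y] [NormedSpace ℂ Y] [CompleteSpace Y]
    {T : ContinuousMultilinearMap ℂ X Y} (φ : MinFactorization 𝔄 T) :
    𝔄.min.nrm X Y T ≤ φ.cost :=
  ciInf_le ⟨0, by rintro _ ⟨ψ, rfl⟩; exact h.cost_nonneg ψ⟩ φ

/-- The product of an element of `ℓ_n(𝔄; E, F)` and a null sequence induces a diagonal operator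
in the minimal kernel. -/
theorem IsNormedIdeal.exists_minFactorization_mul (h : 𝔄.IsNormedIdeal) {y z : ℕ → ℂ}
    (hy : y ∈ (ellN 𝔄 E F).carrier) (hz : Tendsto z atTop (𝓝 0)) :
    ∃ T : ContinuousMultilinearMap ℂ (fun _ : Fin n => E.Elem) F.min.Elem,
      IsDiagonal (y * z) T ∧
      ∃ φ : MinFactorization 𝔄 T, φ.cost ≤ (ellN 𝔄 E F).nrm y * ⨆ k, ‖z k‖ := by
  obtain ⟨S, hS, hyS⟩ := (mem_ellN_iff 𝔄).1 hy
  -- The null sequence is shared equally among the `n + 1` outer factors: one copy of `r` for `A`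
  -- and one for each of the `n` operators on `E`. Their norms multiply to at most `t ^ (n + 1) =
  -- ‖z‖_∞`.
  obtain ⟨r, t, hr, hrz, ht, hrt, htz⟩ := exists_root_tendsto_zero n hz
  let A := KotheSpace.mulOp F F.min r t (F.mul_mem_min r t hr hrt)
  let B := KotheSpace.mulOp E E r t (E.mul_bound hrt)
  have hA : IsApproximable A := KotheSpace.isApproximable_mulOp F.mul_mem_min hr hrt
  have hB : IsApproximable B :=
    KotheSpace.isApproximable_mulOp (fun m C _ hC => E.mul_bound hC) hr hrt
  have hd := hyS.sandwich (A := A) (B := fun _ => B) (KotheSpace.mulOp_seq _)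
    (fun _ => KotheSpace.mulOp_seq _)
  have hyz : (fun k => r k * y k * r k ^ n) = y * z := by
    funext k
    rw [Pi.mul_apply, ← hrz k]
    ring
  rw [hyz] at hd
  let φ : MinFactorization 𝔄 (sandwich A S fun _ => B) :=
    { Z := fun _ => E.Elem
      W := F.Elem
      A := A
      S := S
      B := fun _ => B
      approx_A := hA
      mem_S := hS
      approx_B := fun _ => hB
      eq := rfl }
  refine ⟨_, hd, φ, ?_⟩
  change ‖A‖ * 𝔄.nrm _ _ S * ∏ _i : Fin n, ‖B‖ ≤ _
  have h0 := h.nrm_nonneg hS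
  rw [hyS.ellN_nrm, ← htz, Finset.prod_const, Finset.card_univ, Fintype.card_fin]
  calc ‖A‖ * 𝔄.nrm _ _ S * ‖B‖ ^ n ≤ t * 𝔄.nrm _ _ S * t ^ n := by
        gcongr
        · exact KotheSpace.norm_mulOp_le _ ht
        · exact KotheSpace.norm_mulOp_le _ ht
    _ = _ := by ring

/-- A diagonal operator of the minimal kernel comes, up to `ε`, from the product of an element of
`ℓ_n(𝔄; E, F)` and a null sequence. -/
theorem IsNormedIdeal.exists_mul_of_minFactorization (h : 𝔄.IsNormedIdeal) {α : ℕ → ℂ}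
    {T : ContinuousMultilinearMap ℂ (fun _ : Fin n => E.Elem) F.min.Elem}
    (hT : IsDiagonal α T) (φ : MinFactorization 𝔄 T) {ε : ℝ} (hε : 0 < ε) :
    ∃ y ∈ (ellN 𝔄 E F).carrier, ∃ z : ℕ → ℂ, Tendsto z atTop (𝓝 0) ∧ α = y * z ∧
      (ellN 𝔄 E F).nrm y * ⨆ k, ‖z k‖ ≤ φ.cost + ε := by
  let := φ.instZ₁
  let := φ.instZ₂
  let := φ.instZ₃
  let := φ.instW₁
  let := φ.instW₂
  let := φ.instW₃
  have hS0 := h.nrm_nonneg φ.mem_S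
  have hB0 : 0 ≤ ∏ i, ‖φ.B i‖ := Finset.prod_nonneg fun _ _ => norm_nonneg _
  set K : ℝ := 𝔄.nrm φ.Z φ.W φ.S * ∏ i, ‖φ.B i‖ with hK
  have hK0 : 0 ≤ K := mul_nonneg hS0 hB0
  -- Enlarging `‖A‖` by this amount costs at most `ε` after multiplication by `K`; the summand `1`
  -- covers `K = 0`.
  obtain ⟨A', c, hA', hc, hc1, hcA⟩ := F.factor_approximable φ.approx_A
    (show 0 < ε / (K + 1) by positivity)
  have hc0 : ∀ k, (c k : ℂ) ≠ 0 := fun k => Nat.cast_ne_zero.2 (Nat.one_le_iff_ne_zero.1 (hc1 k))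
  let A'' := F.minIncl.comp A'
  have hA'' : ‖A''‖ ≤ ‖φ.A‖ + ε / (K + 1) :=
    ((ContinuousLinearMap.opNorm_comp_le _ _).trans
      (mul_le_of_le_one_left (norm_nonneg _) F.norm_minIncl_le)).trans hA'
  -- Replacing `A` by `A' = c · A` multiplies the symbol `α` by `c`, whether or not the inner
  -- factors are diagonal.
  have hd : IsDiagonal (fun k => c k * α k) (sandwich A'' φ.S φ.B) := by
    intro x k
    have h1 : (sandwich φ.A φ.S φ.B x).seq k = α k * ∏ i, (x i).seq k := by
      rw [← φ.eq]
      exact hT x k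
    rw [sandwich_apply] at h1 ⊢
    change (F.minIncl (A' _)).seq k = _
    rw [F.minIncl_seq, hcA, h1, mul_assoc]
  have hmem := h.sandwich_mem _ _ _ _ φ.S φ.mem_S A'' φ.B
  refine ⟨_, (mem_ellN_iff 𝔄).2 ⟨_, hmem, hd⟩, fun k => ((c k : ℂ))⁻¹, ?_, ?_, ?_⟩
  · rw [tendsto_zero_iff_norm_tendsto_zero]
    simp only [norm_inv, Complex.norm_natCast]
    exact tendsto_inv_atTop_zero.comp (tendsto_natCast_atTop_atTop.comp hc)
  · funext k
    have := hc0 k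
    rw [Pi.mul_apply]
    field_simp
  · have hz1 : ⨆ k, ‖((c k : ℂ))⁻¹‖ ≤ 1 := ciSup_le fun k => by
      rw [norm_inv, Complex.norm_natCast]
      exact inv_le_one_of_one_le₀ (by exact_mod_cast hc1 k)
    rw [hd.ellN_nrm]
    refine (mul_le_of_le_one_right (h.nrm_nonneg hmem) hz1).trans
      ((h.nrm_sandwich_le _ _ _ _ φ.S φ.mem_S A'' φ.B).trans ?_)
    change _ ≤ ‖φ.A‖ * 𝔄.nrm φ.Z φ.W φ.S * ∏ i, ‖φ.B i‖ + ε
    rw [mul_assoc, mul_assoc, ← hK]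
    have h1 : ε / (K + 1) * K ≤ ε := by
      rw [div_mul_eq_mul_div, div_le_iff₀ (by positivity)]
      nlinarith
    calc ‖A''‖ * K ≤ (‖φ.A‖ + ε / (K + 1)) * K := by gcongr
      _ ≤ ‖φ.A‖ * K + ε := by rw [add_mul]; gcongr

/-- Both norms are infima over factorizations, and the two conversions match these up to an
arbitrary `ε`. -/
theorem IsNormedIdeal.minKernel_ellN (h : 𝔄.IsNormedIdeal) (E F : KotheSpace) :
    (ellN 𝔄 E F).minKernel.IsometricEq (ellN 𝔄.min E F.min) := by
  have hcar : (ellN 𝔄 E F).minKernel.carrier = (ellN 𝔄.min E F.min).carrier := by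
    ext α
    constructor
    · rintro ⟨-, y, hy, z, hz, rfl⟩
      obtain ⟨T, hT, φ, -⟩ := h.exists_minFactorization_mul hy hz
      exact (mem_ellN_iff _).2 ⟨T, ⟨φ⟩, hT⟩
    · intro hα
      obtain ⟨T, ⟨φ⟩, hT⟩ := (mem_ellN_iff _).1 hα
      obtain ⟨y, hy, z, hz, hyz, -⟩ := h.exists_mul_of_minFactorization hT φ one_pos
      exact ⟨hα.1, y, hy, z, hz, hyz⟩
  refine ⟨hcar, fun α hα => ?_⟩
  obtain ⟨T, hTmem, hT⟩ := (mem_ellN_iff _).1 (hcar ▸ hα)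
  have : Nonempty (MinFactorization 𝔄 T) := hTmem
  rw [hT.ellN_nrm]
  -- This bound is used twice: as one of the two inequalities, and as the boundedness from below
  -- needed to estimate the infimum from above.
  have hlow : ∀ r ∈ {r : ℝ | ∃ y ∈ (ellN 𝔄 E F).carrier, ∃ z : ℕ → ℂ, Tendsto z atTop (𝓝 0) ∧
      α = y * z ∧ r = (ellN 𝔄 E F).nrm y * ⨆ k, ‖z k‖}, 𝔄.min.nrm _ _ T ≤ r := by
    rintro r ⟨y, hy, z, hz, rfl, rfl⟩
    obtain ⟨S, hS, φ, hφ⟩ := h.exists_minFactorization_mul hy hz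
    obtain rfl := hS.unique hT
    exact (h.min_nrm_le φ).trans hφ
  apply le_antisymm
  · refine le_ciInf fun φ => le_of_forall_pos_le_add fun ε hε => ?_
    obtain ⟨y, hy, z, hz, hyz, hle⟩ := h.exists_mul_of_minFactorization hT φ hε
    exact (csInf_le ⟨_, hlow⟩ ⟨y, hy, z, hz, hyz, rfl⟩).trans hle
  · obtain ⟨-, y, hy, z, hz, hyz⟩ := hα
    exact le_csInf ⟨_, y, hy, z, hz, hyz, rfl⟩ hlow

/-! ### Dependence on `F` and on `𝔄`, and the conclusion -/

/-- A contractive inclusion is the multiplier `1`. Isometrically equal spaces `G` and `H` still give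
different types of operators, so the passage between them goes through this multiplier in both
directions. -/
theorem IsNormedIdeal.ellN_mono (h : 𝔄.IsNormedIdeal) {G H : KotheSpace}
    (hsub : ∀ x ∈ G.carrier, x ∈ H.carrier ∧ H.nrm x ≤ G.nrm x) {α : ℕ → ℂ}
    (hα : α ∈ (ellN 𝔄 E G).carrier) :
    α ∈ (ellN 𝔄 E H).carrier ∧ (ellN 𝔄 E H).nrm α ≤ (ellN 𝔄 E G).nrm α := by
  have h1 := h.ellN_mul (m := 1) (H := H) (fun x hx => by simpa using hsub x hx) hα
  rwa [one_mul] at h1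

theorem IsNormedIdeal.ellN_congr (h : 𝔄.IsNormedIdeal) (E : KotheSpace) {G H : KotheSpace}
    (hGH : G.toSeqSpace.IsometricEq H.toSeqSpace) :
    (ellN 𝔄 E G).IsometricEq (ellN 𝔄 E H) := by
  have h1 : ∀ x ∈ G.carrier, x ∈ H.carrier ∧ H.nrm x ≤ G.nrm x := fun x hx =>
    ⟨hGH.1 ▸ hx, (hGH.2 x hx).ge⟩
  have h2 : ∀ x ∈ H.carrier, x ∈ G.carrier ∧ G.nrm x ≤ H.nrm x := fun x hx =>
    have hx' : x ∈ G.carrier := hGH.1 ▸ hx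
    ⟨hx', (hGH.2 x hx').le⟩
  refine ⟨Set.Subset.antisymm (fun α hα => (h.ellN_mono h1 hα).1)
    fun α hα => (h.ellN_mono h2 hα).1, fun α hα => ?_⟩
  have h3 := h.ellN_mono h1 hα
  exact le_antisymm (h.ellN_mono h2 h3.1).2 h3.2

theorem IsMinimal.ellN_min (h : 𝔄.IsMinimal) (E F : KotheSpace) :
    (ellN 𝔄 E F).IsometricEq (ellN 𝔄.min E F) := by
  have h1 := h (fun _ => E.Elem) F.Elem
  refine ⟨?_, fun α hα => h1.2 _ hα.2.2⟩
  ext α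
  rw [mem_ellN_iff, mem_ellN_iff, h1.1]

end MultClass

theorem SeqSpace.IsometricEq.trans {X Y Z : SeqSpace} (h : X.IsometricEq Y)
    (h' : Y.IsometricEq Z) : X.IsometricEq Z :=
  ⟨h.1.trans h'.1, fun x hx => (h.2 x hx).trans (h'.2 x (h.1 ▸ hx))⟩

theorem SeqSpace.IsometricEq.symm {X Y : SeqSpace} (h : X.IsometricEq Y) : Y.IsometricEq X :=
  ⟨h.1.symm, fun x hx => (h.2 x (h.1 ▸ hx)).symm⟩

end

theorem proposition2p4 {n : ℕ} (𝔄 : MultClass n) (h𝔄 : 𝔄.IsNormedIdeal) (E F : KotheSpace) :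
    (𝔄.IsBanachIdeal → (ellN 𝔄 E F).IsKothe) ∧
    (𝔄.IsMinimal → F.toSeqSpace.IsMinimal → (ellN 𝔄 E F).IsMinimal) ∧
    (ellN 𝔄 E F).minKernel.IsometricEq (ellN 𝔄.min E F.min) := by
  have hmin := h𝔄.minKernel_ellN E F
  refine ⟨fun h => h.ellN_isKothe E F, fun h hF => ?_, hmin⟩
  have hF' : F.toSeqSpace.IsometricEq F.min.toSeqSpace := hF
  -- The chain is `ℓ_n(𝔄; E, F) = ℓ_n(𝔄; E, F^min) = ℓ_n(𝔄^min; E, F^min) = ℓ_n(𝔄; E, F)^min`.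
  exact ((h𝔄.ellN_congr E hF').trans (h.ellN_min E F.min)).trans hmin.symm
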